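/- For a sequence $(x_k)$ in a Banach space $X$ (real or complex) put $$\operatorname{ca}(x_k)=\inf_{n}\sup\{\|x_k-x_l\| : k,l\ge n\},\qquad \operatorname{cca}(x_k)=\operatorname{ca}\Big(\frac1k\sum_{i=1}^k x_i\Big),$$ and let $\widetilde{\operatorname{cca}}(x_k)$ be the infimum of $\operatorname{cca}(x_{k_n})$ over all subsequences $(x_{k_n})$ of $(x_k)$. For a bounded set $A\subset X$ put $$\operatorname{bs}(A)=\sup\{\widetilde{\operatorname{cca}}(x_k) : (x_k)\subset A\},\qquad \operatorname{wbs}(A)=\sup\{\widetilde{\operatorname{cca}}(x_k) : (x_k)\subset A \text{ is weakly convergent in } X\}.$$ A bounded set $A\subset X$ is a Banach-Saks set if every sequence in $A$ has a subsequence whose arithmetic means converge in norm, and $X$ has the weak Banach-Saks property if every weakly compact subset of $X$ is a Banach-Saks set. Let $B_X$ be the closed unit ball of $X$. **Theorem.** For every Banach space $X$, $$\operatorname{wbs}(B_X)=\begin{cases}0&\text{if } X \text{ has the weak Banach-Saks property},\\ 2&\text{otherwise.}\end{cases}$$ Moreover: * there is a separable reflexive Banach space $X$ with $\operatorname{bs}(B_X)=\operatorname{wbs}(B_X)=2$;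 * there is a nonreflexive Banach space $X$ with separable dual with $\operatorname{bs}(B_X)=\operatorname{wbs}(B_X)=2$; * if $X=C[0,1]$, then $\operatorname{bs}(B_X)=\operatorname{wbs}(B_X)=2$. -/

import Mathlib

universe u v

open Filter Topology

open scoped ENNReal

namespace BanachSaks

/-- The deviation of a sequence from being norm Cauchy:
`ca (x_k) = inf_n sup {‖x_k - x_l‖ : k, l ≥ n}`, as an extended nonnegative real
(it is finite when the sequence is bounded). -/
noncomputable def ca {X : Type*} [NormedAddCommGroup X] (x : ℕ → X) : ℝ≥0∞ :=
  ⨅ n : ℕ, ⨆ k : ℕ, ⨆ l : ℕ, ⨆ _ : n ≤ k, ⨆ _ : n ≤ l, ‖x k - x l‖ₑ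

section

variable (𝕜 : Type*) [RCLike 𝕜] {X : Type*} [NormedAddCommGroup X] [NormedSpace 𝕜 X]

/-- The Cesàro means of a sequence. Sequences are indexed from `0`, so the `k`-th entry is
the arithmetic mean of the first `k + 1` terms `x 0, …, x k`. -/
noncomputable def cesaroMean (x : ℕ → X) (k : ℕ) : X :=
  ((k : 𝕜) + 1)⁻¹ • ∑ i ∈ Finset.range (k + 1), x i

/-- `cca (x_k)`: the quantity `ca` of the sequence of Cesàro means. -/
noncomputable def cca (x : ℕ → X) : ℝ≥0∞ :=
  ca (cesaroMean 𝕜 x)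

/-- `tcca (x_k)`: the infimum of `cca` over all subsequences. -/
noncomputable def tcca (x : ℕ → X) : ℝ≥0∞ :=
  ⨅ φ : ℕ → ℕ, ⨅ _ : StrictMono φ, cca 𝕜 (x ∘ φ)

/-- The sequence converges weakly to some element of the space. -/
def IsWeaklyConvergent (x : ℕ → X) : Prop :=
  ∃ l : X, Tendsto (fun n => toWeakSpace 𝕜 X (x n)) atTop (𝓝 (toWeakSpace 𝕜 X l))

/-- The sequence of Cesàro means converges in norm to some element of the space. -/
def IsCesaroConvergent (x : ℕ → X) : Prop :=
  ∃ l : X, Tendsto (cesaroMean 𝕜 x) atTop (𝓝 l)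

/-- `bs A`: the supremum of `tcca` over all sequences in `A`. -/
noncomputable def bs (A : Set X) : ℝ≥0∞ :=
  ⨆ x : ℕ → X, ⨆ _ : ∀ n, x n ∈ A, tcca 𝕜 x

/-- `wbs A`: the supremum of `tcca` over all sequences in `A` that are weakly convergent in the
ambient space (the limit need not belong to `A`). -/
noncomputable def wbs (A : Set X) : ℝ≥0∞ :=
  ⨆ x : ℕ → X, ⨆ _ : ∀ n, x n ∈ A, ⨆ _ : IsWeaklyConvergent 𝕜 x, tcca 𝕜 x

/-- A Banach-Saks set: a bounded set in which every sequence has a Cesàro convergent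
subsequence. -/
def IsBanachSaksSet (A : Set X) : Prop :=
  Bornology.IsBounded A ∧
    ∀ x : ℕ → X, (∀ n, x n ∈ A) →
      ∃ φ : ℕ → ℕ, StrictMono φ ∧ IsCesaroConvergent 𝕜 (x ∘ φ)

variable (X)

/-- The weak Banach-Saks property: every weakly compact subset is a Banach-Saks set. -/
def HasWeakBanachSaks : Prop :=
  ∀ K : Set X, IsCompact (toWeakSpace 𝕜 X '' K) → IsBanachSaksSet 𝕜 K

/-- Reflexivity: the canonical map into the bidual is onto. -/
def IsReflexive : Prop :=
  Function.Surjective (NormedSpace.inclusionInDoubleDual 𝕜 X)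

end

end BanachSaks

namespace BanachSaks

/-! ### Spreading models along an ultrafilter -/

section SpreadNorm

variable {𝕜 : Type*} [RCLike 𝕜] {X : Type*} [NormedAddCommGroup X] [NormedSpace 𝕜 X]

/-! The triangle inequality bounds `bs` of the unit ball by 2. Under the weak Banach-Saks property,
a weakly convergent sequence together with its limit is a weakly compact set, so some subsequence is
Cesàro convergent and `tcca` vanishes. The substance of the dichotomy is that a single bad sequence
already forces the value 2.

If the property fails, weak sequential compactness and a translation give a bounded weakly null
sequence none of whose subsequences has means tending to 0. Its spreading model then satisfies `‖e₁
+ ⋯ + e_n‖ ≥ δ n` for some `δ > 0`: otherwise a subsequence could be cut into blocks with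
arbitrarily small means (`exists_cesaroMean_tendsto_zero`). Since the sequence is weakly null,
discarding coefficients never increases the spreading norm. This upgrades the estimate on sums of
ones to an `ℓ¹` lower estimate, for nonnegative coefficients by rounding and convexity, and for all
scalars by cutting the plane into finitely many sectors (`exists_pos_mul_le_spreadNorm`).

James' distortion argument then yields normalised blocks, still weakly null, on which the `ℓ¹`
estimate is almost isometric (`exists_weaklyNull_lt_tcca`). In `ℓ¹` the means of the first `K` and
of the first `L` terms are at distance `2 - 2K/L`, and the estimate survives passage to
subsequences, so `tcca` comes arbitrarily close to 2. The outcome is the criterion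
`wbs_eq_two_of_weaklyNull`.

The examples only need to meet that criterion. In Baernstein's space the unit vectors are weakly
null because the basis is shrinking, while `n` vectors far enough out span `ℓ¹` isometrically
because their indices form a Schreier set. The product with `c₀` loses reflexivity and keeps a
separable dual. In `C[0,1]`, functions are built whose sets of simultaneous nonvanishing are
Schreier; they are dominated by Baernstein's basis, hence weakly null. -/

theorem tendsto_limUnder_hyperfilter {f : ℕ → ℝ} {a b : ℝ} (hf : ∀ n, f n ∈ Set.Icc a b) :
    Tendsto f (hyperfilter ℕ : Filter ℕ) (𝓝 (limUnder (hyperfilter ℕ : Filter ℕ) f)) := by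
  apply tendsto_nhds_limUnder
  obtain ⟨l, -, hl⟩ := isCompact_Icc.ultrafilter_le_nhds ((hyperfilter ℕ).map f)
    (by
      rw [le_principal_iff]
      exact Filter.mem_map.2 (Filter.univ_mem' hf))
  exact ⟨l, hl⟩

/-- The iterated limit of `‖v + a₁ x_{n₁} + ⋯ + a_k x_{n_k}‖` along a fixed nonprincipal
ultrafilter, the limit in `n_k` being taken first. For `v = 0` it is the norm of the spreading
model generated by `x`. -/
noncomputable def spreadNorm (x : ℕ → X) : List 𝕜 → X → ℝ
  | [], v => ‖v‖
  | a :: as, v => limUnder (hyperfilter ℕ : Filter ℕ) fun n => spreadNorm x as (v + a • x n)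

@[simp] theorem spreadNorm_nil (x : ℕ → X) (v : X) : spreadNorm x ([] : List 𝕜) v = ‖v‖ := rfl

variable {x : ℕ → X} {C : ℝ}

theorem spreadNorm_mem_Icc (hC : ∀ n, ‖x n‖ ≤ C) (as : List 𝕜) (v : X) :
    spreadNorm x as v ∈ Set.Icc 0 (‖v‖ + C * (as.map norm).sum) := by
  induction as generalizing v with
  | nil => simp
  | cons a as ih =>
    have key : ∀ n, spreadNorm x as (v + a • x n) ∈
        Set.Icc 0 (‖v‖ + C * ((a :: as).map norm).sum) := fun n => by
      refine ⟨(ih _).1, (ih _).2.trans ?_⟩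
      have h1 : ‖v + a • x n‖ ≤ ‖v‖ + ‖a‖ * C := by
        refine (norm_add_le _ _).trans ?_
        rw [norm_smul]
        gcongr
        exact hC n
      simp only [List.map_cons, List.sum_cons]
      linarith
    have ht := tendsto_limUnder_hyperfilter key
    exact isClosed_Icc.mem_of_tendsto ht (Eventually.of_forall key)

theorem tendsto_spreadNorm (hC : ∀ n, ‖x n‖ ≤ C) (a : 𝕜) (as : List 𝕜) (v : X) :
    Tendsto (fun n => spreadNorm x as (v + a • x n)) (hyperfilter ℕ : Filter ℕ)
      (𝓝 (spreadNorm x (a :: as) v)) := by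
  refine tendsto_limUnder_hyperfilter (a := 0)
    (b := ‖v‖ + ‖a‖ * C + C * (as.map norm).sum) fun n => ?_
  refine ⟨(spreadNorm_mem_Icc hC _ _).1, (spreadNorm_mem_Icc hC _ _).2.trans ?_⟩
  have h1 : ‖v + a • x n‖ ≤ ‖v‖ + ‖a‖ * C := by
    refine (norm_add_le _ _).trans ?_
    rw [norm_smul]
    gcongr
    exact hC n
  linarith

theorem spreadNorm_cons_mono (hC : ∀ n, ‖x n‖ ≤ C) {as bs : List 𝕜}
    (h : ∀ v, spreadNorm x as v ≤ spreadNorm x bs v) (a : 𝕜) (v : X) :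
    spreadNorm x (a :: as) v ≤ spreadNorm x (a :: bs) v :=
  le_of_tendsto_of_tendsto' (tendsto_spreadNorm hC a as v) (tendsto_spreadNorm hC a bs v)
    fun _ => h _

/-- For `a = 0` the limit is that of a constant. Thus only the nonzero coefficients and their order
matter, which is the invariance under spreading. -/
theorem spreadNorm_zero_cons (hC : ∀ n, ‖x n‖ ≤ C) (as : List 𝕜) (v : X) :
    spreadNorm x (0 :: as) v = spreadNorm x as v :=
  tendsto_nhds_unique (tendsto_spreadNorm hC 0 as v) (by simp)

theorem spreadNorm_smul (hC : ∀ n, ‖x n‖ ≤ C) (c : 𝕜) (as : List 𝕜) (v : X) :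
    spreadNorm x (as.map (c * ·)) (c • v) = ‖c‖ * spreadNorm x as v := by
  induction as generalizing v with
  | nil => simp [norm_smul]
  | cons a as ih =>
    refine tendsto_nhds_unique (tendsto_spreadNorm hC (c * a) (as.map (c * ·)) (c • v)) ?_
    refine ((tendsto_spreadNorm hC a as v).const_mul ‖c‖).congr fun n => ?_
    rw [← ih, smul_add, smul_smul]

theorem spreadNorm_smul_zero (hC : ∀ n, ‖x n‖ ≤ C) (c : 𝕜) (as : List 𝕜) :
    spreadNorm x (as.map (c * ·)) 0 = ‖c‖ * spreadNorm x as 0 := by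
  simpa using spreadNorm_smul hC c as 0

theorem spreadNorm_add_le (hC : ∀ n, ‖x n‖ ≤ C) {as bs : List 𝕜} (h : as.length = bs.length)
    (v w : X) :
    spreadNorm x (List.zipWith (· + ·) as bs) (v + w) ≤
      spreadNorm x as v + spreadNorm x bs w := by
  induction as generalizing bs v w with
  | nil =>
    cases bs with
    | nil => simpa using norm_add_le v w
    | cons b bs => simp at h
  | cons a as ih =>
    cases bs with
    | nil => simp at h
    | cons b bs =>
      refine le_of_tendsto_of_tendsto' (tendsto_spreadNorm hC (a + b) _ (v + w))
        ((tendsto_spreadNorm hC a as v).add (tendsto_spreadNorm hC b bs w)) fun n => ?_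
      have := ih (bs := bs) (by simpa using h) (v + a • x n) (w + b • x n)
      rwa [show v + w + (a + b) • x n = v + a • x n + (w + b • x n) by
        rw [add_smul]; abel]

theorem spreadNorm_add_left_le (hC : ∀ n, ‖x n‖ ≤ C) (as : List 𝕜) (v w : X) :
    spreadNorm x as (v + w) ≤ spreadNorm x as v + ‖w‖ := by
  induction as generalizing v with
  | nil => simpa using norm_add_le v w
  | cons a as ih =>
    refine le_of_tendsto_of_tendsto' (tendsto_spreadNorm hC a as (v + w))
      ((tendsto_spreadNorm hC a as v).add_const _) fun n => ?_
    have := ih (v + a • x n)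
    rwa [show v + w + a • x n = v + a • x n + w by abel]

/-- Changing the coefficients changes the spreading norm by at most the bound `C` times the
`ℓ¹`-norm of the change. -/
theorem spreadNorm_map_le (hC : ∀ n, ‖x n‖ ≤ C) (f g : 𝕜 → 𝕜) (as : List 𝕜) (v : X) :
    spreadNorm x (as.map f) v ≤
      spreadNorm x (as.map g) v + C * (as.map fun a => ‖f a - g a‖).sum := by
  induction as generalizing v with
  | nil => simp
  | cons a as ih =>
    refine le_of_tendsto_of_tendsto' (tendsto_spreadNorm hC (f a) (as.map f) v)
      ((tendsto_spreadNorm hC (g a) (as.map g) v).add_const _) fun n => ?_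
    have h1 := spreadNorm_add_left_le hC (as.map g) (v + g a • x n) ((f a - g a) • x n)
    have h2 := ih (v + f a • x n)
    have h3 : ‖(f a - g a) • x n‖ ≤ ‖f a - g a‖ * C := by
      rw [norm_smul]; gcongr; exact hC n
    rw [show v + g a • x n + (f a - g a) • x n = v + f a • x n by rw [sub_smul]; abel] at h1
    simp only [List.map_cons, List.sum_cons]
    linarith

theorem continuous_spreadNorm (hC : ∀ n, ‖x n‖ ≤ C) (as : List 𝕜) :
    Continuous (spreadNorm x as) := by
  refine continuous_iff_continuousAt.2 fun v => ?_
  rw [ContinuousAt, tendsto_iff_norm_sub_tendsto_zero]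
  refine squeeze_zero (fun _ => norm_nonneg _) (fun w => ?_)
    (tendsto_iff_norm_sub_tendsto_zero.1 (tendsto_id (α := X) (x := 𝓝 v)))
  rw [Real.norm_eq_abs, abs_le, id]
  have h1 := spreadNorm_add_left_le hC as v (w - v)
  have h2 := spreadNorm_add_left_le hC as w (v - w)
  rw [norm_sub_rev v w] at h2
  simp only [add_sub_cancel] at h1 h2
  constructor <;> linarith

theorem spreadNorm_convex_comb_le (hC : ∀ n, ‖x n‖ ≤ C) (as : List 𝕜) {s t : ℝ} (hs : 0 ≤ s)
    (ht : 0 ≤ t) (hst : s + t = 1) (v w : X) :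
    spreadNorm x as ((s : 𝕜) • v + (t : 𝕜) • w) ≤
      s * spreadNorm x as v + t * spreadNorm x as w := by
  have h := spreadNorm_add_le hC (as := as.map ((s : 𝕜) * ·)) (bs := as.map ((t : 𝕜) * ·))
    (by simp) ((s : 𝕜) • v) ((t : 𝕜) • w)
  rw [spreadNorm_smul hC, spreadNorm_smul hC, RCLike.norm_ofReal, RCLike.norm_ofReal,
    abs_of_nonneg hs, abs_of_nonneg ht] at h
  convert h using 2
  rw [List.zipWith_map, List.zipWith_self]
  conv_lhs => rw [← List.map_id as]
  refine List.map_congr_left fun a _ => ?_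
  rw [← add_mul, ← RCLike.ofReal_add, hst]
  simp

/-- Weakly null sequences, expressed through functionals. -/
def WeaklyNull (𝕜 : Type*) [RCLike 𝕜] {X : Type*} [NormedAddCommGroup X] [NormedSpace 𝕜 X]
    (x : ℕ → X) : Prop :=
  ∀ g : StrongDual 𝕜 X, Tendsto (fun n => g (x n)) atTop (𝓝 0)

/-- `v` is the weak limit of `v + a • x n`, and a convex continuous function is weakly lower
semicontinuous. The proof separates `v` from a closed convex sublevel set that contains `v + a • x
n` for ultrafilter-many `n`. -/
theorem spreadNorm_le_cons (hC : ∀ n, ‖x n‖ ≤ C) (hx : WeaklyNull 𝕜 x) (a : 𝕜) (as : List 𝕜)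
    (v : X) : spreadNorm x as v ≤ spreadNorm x (a :: as) v := by
  by_contra! hlt
  obtain ⟨c, hc1, hc2⟩ := exists_between hlt
  let _ : NormedSpace ℝ X := NormedSpace.restrictScalars ℝ 𝕜 X
  have : IsScalarTower ℝ 𝕜 X := inferInstance
  have hconv : Convex ℝ {w | spreadNorm x as w ≤ c} := by
    intro w hw w' hw' s t hs ht hst
    have h := spreadNorm_convex_comb_le hC as hs ht hst w w'
    simp only [Set.mem_ofPred_eq] at hw hw' ⊢
    have e1 : s • w = (s : 𝕜) • w := by rw [RCLike.real_smul_eq_coe_smul (K := 𝕜)]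
    have e2 : t • w' = (t : 𝕜) • w' := by rw [RCLike.real_smul_eq_coe_smul (K := 𝕜)]
    rw [e1, e2]
    have h1 := mul_le_mul_of_nonneg_left hw hs
    have h2 := mul_le_mul_of_nonneg_left hw' ht
    have h3 : s * c + t * c = c := by rw [← add_mul, hst, one_mul]
    linarith
  have hclosed : IsClosed {w | spreadNorm x as w ≤ c} :=
    isClosed_le (continuous_spreadNorm hC as) continuous_const
  obtain ⟨f, r, hf, hv⟩ := RCLike.geometric_hahn_banach_closed_point (𝕜 := 𝕜)
    (x := v) hconv hclosed (by simpa using hc2)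
  have h1 : Tendsto (fun n => RCLike.re (f (v + a • x n))) (hyperfilter ℕ : Filter ℕ)
      (𝓝 (RCLike.re (f v))) := by
    have h0 : Tendsto (fun n => f (x n)) (hyperfilter ℕ : Filter ℕ) (𝓝 0) :=
      (hx f).mono_left (by simpa using Nat.hyperfilter_le_atTop)
    have h2 : Tendsto (fun n => f v + a * f (x n)) (hyperfilter ℕ : Filter ℕ)
        (𝓝 (f v + a * 0)) := (h0.const_mul a).const_add (f v)
    have h3 := (RCLike.continuous_re.tendsto _).comp h2
    simpa [Function.comp_def] using h3
  have h2 : ∀ᶠ n in (hyperfilter ℕ : Filter ℕ), spreadNorm x as (v + a • x n) < c :=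
    (tendsto_spreadNorm hC a as v).eventually_lt_const hc1
  have h3 : ∀ᶠ n in (hyperfilter ℕ : Filter ℕ), r < RCLike.re (f (v + a • x n)) :=
    h1.eventually_const_lt hv
  obtain ⟨n, hn1, hn2⟩ := (h2.and h3).exists
  exact absurd (hf _ hn1.le) (not_lt.2 hn2.le)

-- Suppression unconditionality: each deleted coefficient is first replaced by 0, then dropped by
-- spreading invariance, and `spreadNorm_le_cons` compares the two lists.
open Classical in
theorem spreadNorm_suppress (hC : ∀ n, ‖x n‖ ≤ C) (hx : WeaklyNull 𝕜 x) (p : 𝕜 → Prop)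
    (as : List 𝕜) (v : X) :
    spreadNorm x (as.map fun a => if p a then a else 0) v ≤ spreadNorm x as v := by
  induction as generalizing v with
  | nil => simp
  | cons a as ih =>
    by_cases hp : p a
    · simpa [hp] using spreadNorm_cons_mono hC ih a v
    · simp only [List.map_cons, hp, if_false]
      rw [spreadNorm_zero_cons hC]
      exact (ih v).trans (spreadNorm_le_cons hC hx a as v)

/-- `(p, q, …)` is a convex combination of `(p + q, 0, …)` and `(0, p + q, …)`, with weights `p / (p
+ q)` and `q / (p + q)`, and both have the norm of `(p + q, …)`. Iterated, this compares a sum of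
ones with any list of natural coefficients of the same total. -/
theorem spreadNorm_split (hC : ∀ n, ‖x n‖ ≤ C) (p q : ℕ) (as : List 𝕜) (v : X) :
    spreadNorm x ((p : 𝕜) :: (q : 𝕜) :: as) v ≤ spreadNorm x (((p + q : ℕ) : 𝕜) :: as) v := by
  rcases Nat.eq_zero_or_pos (p + q) with h0 | hpos
  · obtain ⟨rfl, rfl⟩ : p = 0 ∧ q = 0 := by omega
    simp [spreadNorm_zero_cons hC]
  have hpq : ((p + q : ℕ) : ℝ) ≠ 0 := by positivity
  have hpq' : ((p + q : ℕ) : 𝕜) ≠ 0 := by exact_mod_cast hpos.ne'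
  set s : ℝ := p / (p + q : ℕ) with hs
  set t : ℝ := q / (p + q : ℕ) with ht
  have hst : s + t = 1 := by rw [hs, ht, ← add_div, ← Nat.cast_add, div_self hpq]
  have hs' : (s : 𝕜) * ((p + q : ℕ) : 𝕜) = p := by
    rw [hs]; push_cast; push_cast at hpq'; field_simp
  have ht' : (t : 𝕜) * ((p + q : ℕ) : 𝕜) = q := by
    rw [ht]; push_cast; push_cast at hpq'; field_simp
  have hst' : (s : 𝕜) + (t : 𝕜) = 1 := by rw [← RCLike.ofReal_add, hst]; simp
  have hs0 : 0 ≤ s := by positivity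
  have ht0 : 0 ≤ t := by positivity
  have h := spreadNorm_add_le hC (as := (((p + q : ℕ) : 𝕜) :: 0 :: as).map ((s : 𝕜) * ·))
    (bs := (0 :: ((p + q : ℕ) : 𝕜) :: as).map ((t : 𝕜) * ·))
    (by simp) ((s : 𝕜) • v) ((t : 𝕜) • v)
  rw [spreadNorm_smul hC, spreadNorm_smul hC, spreadNorm_zero_cons hC, ← add_smul, hst',
    one_smul, RCLike.norm_ofReal, RCLike.norm_ofReal, abs_of_nonneg hs0, abs_of_nonneg ht0] at h
  have e : spreadNorm x (((p + q : ℕ) : 𝕜) :: 0 :: as) v =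
      spreadNorm x (((p + q : ℕ) : 𝕜) :: as) v :=
    le_antisymm (spreadNorm_cons_mono hC (fun w => (spreadNorm_zero_cons hC as w).le) _ v)
      (spreadNorm_cons_mono hC (fun w => (spreadNorm_zero_cons hC as w).ge) _ v)
  rw [e, ← add_mul, hst, one_mul] at h
  refine le_trans (le_of_eq ?_) h
  congr 1
  simp only [List.map_cons, List.zipWith_cons_cons, hs', ht', mul_zero, add_zero, zero_add]
  rw [List.zipWith_map, List.zipWith_self]
  conv_lhs => rw [← List.map_id as]
  congr 2
  refine List.map_congr_left fun a _ => ?_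
  rw [← add_mul, hst']
  simp

theorem spreadNorm_replicate_append_le (hC : ∀ n, ‖x n‖ ≤ C) (p : ℕ) (as : List 𝕜) (v : X) :
    spreadNorm x (List.replicate p 1 ++ as) v ≤ spreadNorm x ((p : 𝕜) :: as) v := by
  induction p generalizing v with
  | zero => simp [spreadNorm_zero_cons hC]
  | succ p ih =>
    have h1 := spreadNorm_cons_mono hC ih (1 : 𝕜) v
    have h2 := spreadNorm_split hC 1 p as v
    rw [Nat.cast_one, add_comm 1 p] at h2
    rw [List.replicate_succ]
    exact h1.trans h2

theorem spreadNorm_replicate_sum_le (hC : ∀ n, ‖x n‖ ≤ C) (ps : List ℕ) (v : X) :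
    spreadNorm x (List.replicate ps.sum (1 : 𝕜)) v ≤
      spreadNorm x (ps.map (Nat.cast : ℕ → 𝕜)) v := by
  induction ps generalizing v with
  | nil => simp
  | cons p ps ih =>
    have h1 := spreadNorm_cons_mono hC ih (p : 𝕜) v
    have h2 := spreadNorm_replicate_append_le hC p (List.replicate ps.sum (1 : 𝕜)) v
    rw [List.sum_cons, List.replicate_add]
    exact h2.trans h1

end SpreadNorm

/-! ### From sums of ones to an `ℓ¹` lower estimate -/

section LowerEstimate

variable {𝕜 : Type*} [RCLike 𝕜] {X : Type*} [NormedAddCommGroup X] [NormedSpace 𝕜 X]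
variable {x : ℕ → X} {C : ℝ}

/-- Natural coefficients are handled by `spreadNorm_replicate_sum_le`. Real ones are multiplied by a
large `t`, rounded down, and divided by `t` again. -/
theorem le_spreadNorm_of_nonneg (hC : ∀ n, ‖x n‖ ≤ C) {δ : ℝ} (hδ0 : 0 ≤ δ)
    (hδ : ∀ n : ℕ, δ * n ≤ spreadNorm x (List.replicate n (1 : 𝕜)) 0) (as : List 𝕜) :
    δ * (as.map norm).sum ≤ spreadNorm x (as.map fun a => ((‖a‖ : ℝ) : 𝕜)) 0 := by
  have hC0 : 0 ≤ C := (norm_nonneg _).trans (hC 0)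
  set S := (as.map norm).sum
  set N := spreadNorm x (as.map fun a => ((‖a‖ : ℝ) : 𝕜)) 0
  -- Rounding moves each coefficient by at most 1, so the error depends on the length of the list
  -- and not on `t`; letting `t` grow makes it negligible.
  have key : ∀ t : ℕ, t * (δ * S - N) ≤ (δ + C) * as.length := fun t => by
    have h1 : spreadNorm x (as.map fun a => (((t : ℝ) * ‖a‖ : ℝ) : 𝕜)) 0 = t * N := by
      have := spreadNorm_smul_zero hC (t : 𝕜) (as.map fun a => ((‖a‖ : ℝ) : 𝕜))
      rw [List.map_map, RCLike.norm_natCast] at this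
      rw [← this]
      congr 1
      exact List.map_congr_left fun a _ => by simp
    have h2 := spreadNorm_map_le hC (fun a => ((⌊(t : ℝ) * ‖a‖⌋₊ : ℕ) : 𝕜))
      (fun a => (((t : ℝ) * ‖a‖ : ℝ) : 𝕜)) as 0
    have hfl : ∀ a : 𝕜, |(⌊(t : ℝ) * ‖a‖⌋₊ : ℝ) - t * ‖a‖| ≤ 1 := fun a => by
      have h0 : 0 ≤ (t : ℝ) * ‖a‖ := by positivity
      have := Nat.floor_le h0
      have := Nat.lt_floor_add_one ((t : ℝ) * ‖a‖)
      rw [abs_le]; constructor <;> linarith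
    have h3 : (as.map fun a => ‖((⌊(t : ℝ) * ‖a‖⌋₊ : ℕ) : 𝕜) - (((t : ℝ) * ‖a‖ : ℝ) : 𝕜)‖).sum
        ≤ as.length := by
      have : (as.map fun a => ‖((⌊(t : ℝ) * ‖a‖⌋₊ : ℕ) : 𝕜) - (((t : ℝ) * ‖a‖ : ℝ) : 𝕜)‖).sum
          ≤ (as.map fun _ => (1 : ℝ)).sum := by
        refine List.sum_le_sum fun a _ => ?_
        have e : ((⌊(t : ℝ) * ‖a‖⌋₊ : ℕ) : 𝕜) - (((t : ℝ) * ‖a‖ : ℝ) : 𝕜) =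
            (((⌊(t : ℝ) * ‖a‖⌋₊ : ℝ) - t * ‖a‖ : ℝ) : 𝕜) := by push_cast; rfl
        rw [e, RCLike.norm_ofReal]
        exact hfl a
      simpa using this
    have h4 := spreadNorm_replicate_sum_le (𝕜 := 𝕜) hC (as.map fun a => ⌊(t : ℝ) * ‖a‖⌋₊) 0
    rw [List.map_map] at h4
    have h5 := hδ (as.map fun a => ⌊(t : ℝ) * ‖a‖⌋₊).sum
    have h6 : t * S - as.length ≤ ((as.map fun a => ⌊(t : ℝ) * ‖a‖⌋₊).sum : ℝ) := by
      have : ∀ l : List 𝕜, t * (l.map norm).sum - l.length ≤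
          ((l.map fun a => ⌊(t : ℝ) * ‖a‖⌋₊).sum : ℝ) := fun l => by
        induction l with
        | nil => simp
        | cons b l ih =>
          have := (abs_le.1 (hfl b)).1
          simp only [List.map_cons, List.sum_cons, List.length_cons, Nat.cast_add, Nat.cast_one]
          linarith
      exact this as
    have h7 := mul_le_mul_of_nonneg_left h6 hδ0
    have h8 := mul_le_mul_of_nonneg_left h3 hC0
    rw [h1] at h2
    have h9 : spreadNorm x (as.map ((Nat.cast : ℕ → 𝕜) ∘ fun a => ⌊(t : ℝ) * ‖a‖⌋₊)) 0 =
      spreadNorm x (as.map fun a => ((⌊(t : ℝ) * ‖a‖⌋₊ : ℕ) : 𝕜)) 0 := rfl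
    linarith
  by_contra! hlt
  obtain ⟨t, ht⟩ := exists_nat_gt ((δ + C) * as.length / (δ * S - N))
  rw [div_lt_iff₀ (by linarith)] at ht
  exact absurd (key t) (not_le.2 ht)

/-- If the spreading norm of `e₁ + ⋯ + e_n` is at least `δ n` for all `n`, then the spreading
model of a weakly null sequence is isomorphic to `ℓ¹`. -/
theorem exists_pos_mul_le_spreadNorm (hC : ∀ n, ‖x n‖ ≤ C) (hx : WeaklyNull 𝕜 x) {δ : ℝ}
    (hδ0 : 0 < δ) (hδ : ∀ n : ℕ, δ * n ≤ spreadNorm x (List.replicate n (1 : 𝕜)) 0) :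
    ∃ c > 0, ∀ as : List 𝕜, c * (as.map norm).sum ≤ spreadNorm x as 0 := by
  classical
  have hC0 : 0 ≤ C := (norm_nonneg _).trans (hC 0)
  -- The angular width of the sectors: replacing a coefficient by a positive multiple of the
  -- sector's direction must cost at most half of `δ`, that is `C * η ≤ δ / 2`.
  set η : ℝ := δ / (2 * (C + 1)) with hη
  have hηpos : 0 < η := by positivity
  have hηC : C * η ≤ δ / 2 := by
    rw [hη, mul_div_assoc', div_le_div_iff₀ (by positivity) (by norm_num)]
    nlinarith
  obtain ⟨T, hTs, hTfin, hT⟩ :=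
    (isCompact_sphere (0 : 𝕜) 1).finite_cover_balls hηpos
  have hTone : ∀ θ ∈ T, ‖θ‖ = 1 := fun θ hθ => by simpa using hTs hθ
  -- Keep only the coefficients in the sector around `θ`, which does not increase the norm; up to
  -- the error `C * η` per unit of mass they are `θ` times nonnegative numbers.
  have hsector : ∀ θ ∈ T, ∀ as : List 𝕜,
      δ / 2 * (as.map fun a => if ‖a - θ * ((‖a‖ : ℝ) : 𝕜)‖ ≤ η * ‖a‖ then ‖a‖ else 0).sum ≤
        spreadNorm x as 0 := by
    intro θ hθ as
    set p : 𝕜 → Prop := fun a => ‖a - θ * ((‖a‖ : ℝ) : 𝕜)‖ ≤ η * ‖a‖ with hp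
    set bs := as.map fun a => if p a then a else 0 with hbs
    have h1 : spreadNorm x bs 0 ≤ spreadNorm x as 0 := spreadNorm_suppress hC hx p as 0
    have hsum : (bs.map norm).sum = (as.map fun a => if p a then ‖a‖ else 0).sum := by
      rw [hbs, List.map_map]
      congr 1
      refine List.map_congr_left fun a _ => ?_
      by_cases h : p a <;> simp [h]
    have h2 := le_spreadNorm_of_nonneg hC hδ0.le hδ bs
    have h3 := spreadNorm_smul_zero hC θ (bs.map fun a => ((‖a‖ : ℝ) : 𝕜))
    rw [hTone θ hθ, one_mul, List.map_map] at h3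
    have h4 := spreadNorm_map_le hC ((θ * ·) ∘ fun a : 𝕜 => ((‖a‖ : ℝ) : 𝕜)) id bs 0
    rw [List.map_id] at h4
    have h5 : (bs.map fun a => ‖((θ * ·) ∘ fun a : 𝕜 => ((‖a‖ : ℝ) : 𝕜)) a - id a‖).sum ≤
        η * (bs.map norm).sum := by
      rw [← List.sum_map_mul_left]
      refine List.sum_le_sum fun b hb => ?_
      obtain ⟨a, -, rfl⟩ := List.mem_map.1 hb
      by_cases h : p a
      · simp only [h, if_true, Function.comp_apply, id]
        rw [norm_sub_rev]
        exact h
      · simp [h]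
    have h6 := mul_le_mul_of_nonneg_left h5 hC0
    have h7 : 0 ≤ (bs.map norm).sum := List.sum_nonneg (by simp)
    rw [hsum] at h2 h6 h7
    nlinarith [mul_le_mul_of_nonneg_right hηC h7]
  have hcover : ∀ a : 𝕜, ∃ θ ∈ T, ‖a - θ * ((‖a‖ : ℝ) : 𝕜)‖ ≤ η * ‖a‖ := by
    have hT' : ∀ u : 𝕜, ‖u‖ = 1 → ∃ θ ∈ T, ‖u - θ‖ < η := fun u hu => by
      have := hT (show u ∈ Metric.sphere (0 : 𝕜) 1 by simpa using hu)
      simpa [dist_eq_norm] using this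
    intro a
    rcases eq_or_ne a 0 with rfl | ha
    · obtain ⟨θ, hθ, -⟩ := hT' 1 (by simp)
      exact ⟨θ, hθ, by simp⟩
    · have ha' : ((‖a‖ : ℝ) : 𝕜) ≠ 0 := by simpa using ha
      obtain ⟨θ, hθ, h⟩ := hT' (a / ((‖a‖ : ℝ) : 𝕜)) (by
        rw [norm_div, RCLike.norm_ofReal, abs_norm, div_self (norm_ne_zero_iff.2 ha)])
      refine ⟨θ, hθ, ?_⟩
      have e : a - θ * ((‖a‖ : ℝ) : 𝕜) = (a / ((‖a‖ : ℝ) : 𝕜) - θ) * ((‖a‖ : ℝ) : 𝕜) := by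
        field_simp
      rw [e, norm_mul, RCLike.norm_ofReal, abs_norm]
      gcongr
  lift T to Finset 𝕜 using hTfin
  have hsum : ∀ as : List 𝕜, (as.map norm).sum ≤ ∑ θ ∈ T,
      (as.map fun a => if ‖a - θ * ((‖a‖ : ℝ) : 𝕜)‖ ≤ η * ‖a‖ then ‖a‖ else 0).sum := by
    intro as
    induction as with
    | nil => simp
    | cons a as ih =>
      simp only [List.map_cons, List.sum_cons, Finset.sum_add_distrib]
      refine add_le_add ?_ ih
      obtain ⟨θ, hθ, h⟩ := hcover a
      refine le_trans ?_ (Finset.single_le_sum (f := fun θ =>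
        if ‖a - θ * ((‖a‖ : ℝ) : 𝕜)‖ ≤ η * ‖a‖ then ‖a‖ else 0) (fun i _ => ?_) hθ)
      · simp [h]
      · split_ifs <;> simp
  -- The sectors together carry the whole `ℓ¹`-mass and each is bounded by the full spreading norm,
  -- whence division by their number; the `+ 1` only keeps the denominator positive.
  refine ⟨δ / 2 / (T.card + 1), by positivity, fun as => ?_⟩
  have h1 := mul_le_mul_of_nonneg_left (hsum as) (by positivity : 0 ≤ δ / 2)
  rw [Finset.mul_sum] at h1
  have h2 := h1.trans (Finset.sum_le_sum fun θ hθ => hsector θ hθ as)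
  rw [Finset.sum_const, nsmul_eq_mul] at h2
  have h3 := (spreadNorm_mem_Icc hC as 0).1
  rw [div_mul_eq_mul_div, div_le_iff₀ (by positivity)]
  linarith

end LowerEstimate

/-! ### Extracting subsequences that realise the spreading model -/

section Extraction

variable {𝕜 : Type*} [RCLike 𝕜] {X : Type*} [NormedAddCommGroup X] [NormedSpace 𝕜 X]
variable {x : ℕ → X} {C : ℝ}

/-- Each term is chosen with `m` one more than the preceding term, so `Q m` may impose conditions on
everything chosen before. -/
theorem exists_strictMono_of_forall_exists {Q : ℕ → ℕ → Prop} (h : ∀ m, ∃ n ≥ m, Q m n) :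
    ∃ φ : ℕ → ℕ, StrictMono φ ∧ ∀ n, ∃ m, (∀ i < n, φ i < m) ∧ n ≤ m ∧ Q m (φ n) := by
  choose f hf hQ using h
  let φ : ℕ → ℕ := fun n => Nat.rec (f 0) (fun _ p => f (p + 1)) n
  have hφ : StrictMono φ := strictMono_nat_of_lt_succ fun n => (hf (φ n + 1))
  refine ⟨φ, hφ, fun n => ?_⟩
  cases n with
  | zero => exact ⟨0, by simp, le_rfl, hQ 0⟩
  | succ n =>
    exact ⟨φ n + 1, fun i hi => Nat.lt_succ_of_le (hφ.monotone (Nat.le_of_lt_succ hi)),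
      Nat.succ_le_succ hφ.le_apply, hQ (φ n + 1)⟩

/-- The linear combination `∑ β_j x_{t_j}`. -/
def comb (x : ℕ → X) (β : List 𝕜) (t : List ℕ) : X :=
  (List.zipWith (fun b n => b • x n) β t).sum

@[simp] theorem comb_nil_right (x : ℕ → X) (β : List 𝕜) : comb x β [] = 0 := by
  simp [comb]

@[simp] theorem comb_nil_left (x : ℕ → X) (t : List ℕ) : comb x ([] : List 𝕜) t = 0 := by
  simp [comb]

@[simp] theorem comb_cons (x : ℕ → X) (b : 𝕜) (β : List 𝕜) (n : ℕ) (t : List ℕ) :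
    comb x (b :: β) (n :: t) = b • x n + comb x β t := by
  simp [comb]

theorem comb_append (x : ℕ → X) {β β' : List 𝕜} {t t' : List ℕ} (h : β.length = t.length) :
    comb x (β ++ β') (t ++ t') = comb x β t + comb x β' t' := by
  simp [comb, List.zipWith_append h]

theorem comb_map (x : ℕ → X) (φ : ℕ → ℕ) (β : List 𝕜) (t : List ℕ) :
    comb x β (t.map φ) = comb (x ∘ φ) β t := by
  simp [comb, List.zipWith_map_right]

theorem comb_smul (x : ℕ → X) (c : 𝕜) (β : List 𝕜) (t : List ℕ) :
    comb x (β.map (c * ·)) t = c • comb x β t := by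
  induction β generalizing t with
  | nil => simp
  | cons b β ih =>
    cases t with
    | nil => simp
    | cons n t => simp [ih, smul_add, mul_smul]

theorem comb_concat (x : ℕ → X) (β : List 𝕜) (s : List ℕ) (n : ℕ) (h : s.length < β.length) :
    comb x β (s ++ [n]) = comb x β s + β[s.length] • x n := by
  induction s generalizing β with
  | nil =>
    cases β with
    | nil => simp at h
    | cons b β => simp
  | cons m s ih =>
    cases β with
    | nil => simp at h
    | cons b β =>
      have := ih β (by simpa using h)
      simp only [List.cons_append, comb_cons, this, List.length_cons, List.getElem_cons_succ]
      abel

theorem length_le_of_pairwise_lt {t : List ℕ} (ht : t.Pairwise (· < ·)) {n : ℕ}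
    (h : ∀ i ∈ t, i < n) : t.length ≤ n := by
  have h1 : t.Nodup := ht.imp fun h => h.ne
  have h2 : t.toFinset ⊆ Finset.range n := fun i hi => by
    simpa using h i (by simpa using hi)
  simpa [List.toFinset_card_of_nodup h1] using Finset.card_le_card h2

theorem finite_lists_lt (m : ℕ) : {s : List ℕ | (∀ i ∈ s, i < m) ∧ s.length ≤ m}.Finite := by
  refine ((List.finite_length_le (Fin m) m).image (List.map Fin.val)).subset ?_
  rintro s ⟨hs, hl⟩
  lift s to List (Fin m) using hs
  exact ⟨s, by simpa using hl, rfl⟩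

/-- Subsequences generating the spreading model: the norms of prescribed linear combinations of
terms far enough in the subsequence are as close as we like to their spreading norms. -/
theorem exists_strictMono_norm_comb_near (hC : ∀ n, ‖x n‖ ≤ C) (β : ℕ → List 𝕜) {ε : ℕ → ℝ}
    (hε : ∀ k, 0 < ε k) :
    ∃ φ : ℕ → ℕ, StrictMono φ ∧ ∀ k, ∀ t : List ℕ, t.Pairwise (· < ·) → (∀ i ∈ t, k ≤ i) →
      t.length = (β k).length → |‖comb (x ∘ φ) (β k) t‖ - spreadNorm x (β k) 0| < ε k := by
  -- A partially evaluated combination: actual terms of the sequence stand for the first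
  -- coefficients, iterated limits for the rest. It is good if it is still within `ε k` of the full
  -- spreading norm.
  set Good : ℕ → List ℕ → Prop := fun k s =>
    |spreadNorm x ((β k).drop s.length) (comb x (β k) s) - spreadNorm x (β k) 0| < ε k with hGood
  have hR : ∀ k s, ∀ᶠ n in (hyperfilter ℕ : Filter ℕ),
      Good k s → s.length < (β k).length → Good k (s ++ [n]) := by
    intro k s
    by_cases hg : Good k s
    swap
    · exact Eventually.of_forall fun n h => absurd h hg
    by_cases hl : s.length < (β k).length
    swap
    · exact Eventually.of_forall fun n _ h => absurd h hl
    have h1 := tendsto_spreadNorm hC (β k)[s.length] ((β k).drop (s.length + 1))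
      (comb x (β k) s)
    rw [List.cons_getElem_drop_succ] at h1
    have h2 := ((h1.sub_const (spreadNorm x (β k) 0)).abs).eventually_lt_const hg
    filter_upwards [h2] with n hn _ _
    simp only [hGood, List.length_append, List.length_singleton, comb_concat x (β k) s n hl]
    exact hn
  -- Only finitely many `k` and `s` are in play at stage `m`, so one `n` can extend all good partial
  -- evaluations at once.
  have hQ : ∀ m, ∃ n ≥ m, ∀ k ≤ m, ∀ s : List ℕ, (∀ i ∈ s, i < m) → s.length ≤ m →
      Good k s → s.length < (β k).length → Good k (s ++ [n]) := by
    intro m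
    have h1 : ∀ᶠ n in (hyperfilter ℕ : Filter ℕ), ∀ k ∈ Set.Iic m,
        ∀ s ∈ {s : List ℕ | (∀ i ∈ s, i < m) ∧ s.length ≤ m},
          Good k s → s.length < (β k).length → Good k (s ++ [n]) :=
      (eventually_all_finite (Set.finite_Iic m)).2 fun k _ =>
        (eventually_all_finite (finite_lists_lt m)).2 fun s _ => hR k s
    have h2 : ∀ᶠ n in (hyperfilter ℕ : Filter ℕ), m ≤ n :=
      (eventually_ge_atTop m).filter_mono (by simpa using Nat.hyperfilter_le_atTop)
    obtain ⟨n, hn1, hn2⟩ := (h1.and h2).exists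
    exact ⟨n, hn2, fun k hk s hs hl => hn1 k hk s ⟨hs, hl⟩⟩
  obtain ⟨φ, hφ, hφQ⟩ := exists_strictMono_of_forall_exists hQ
  refine ⟨φ, hφ, fun k => ?_⟩
  have key : ∀ t : List ℕ, t.Pairwise (· < ·) → (∀ i ∈ t, k ≤ i) →
      t.length ≤ (β k).length → Good k (t.map φ) := by
    intro t
    induction t using List.reverseRecOn with
    | nil => intro _ _ _; simpa [hGood] using hε k
    | append_singleton t n ih =>
      intro h1 h2 h3
      rw [List.pairwise_append] at h1
      have hlt : ∀ i ∈ t, i < n := fun i hi => h1.2.2 i hi n (by simp)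
      have hlen : t.length < (β k).length := by simpa using h3
      obtain ⟨m, hm1, hm2, hm3⟩ := hφQ n
      rw [List.map_append]
      refine hm3 k ((h2 n (by simp)).trans hm2) _ ?_ ?_
        (ih h1.1 (fun i hi => h2 i (by simp [hi])) hlen.le) (by simpa using hlen)
      · intro i hi
        obtain ⟨j, hj, rfl⟩ := List.mem_map.1 hi
        exact hm1 j (hlt j hj)
      · rw [List.length_map]
        exact (length_le_of_pairwise_lt h1.1 hlt).trans hm2
  intro t h1 h2 h3
  have := key t h1 h2 h3.le
  simpa [hGood, h3, comb_map] using this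

end Extraction

/-! ### Bookkeeping for linear combinations given by lists -/

section Lists

variable {𝕜 : Type*} [RCLike 𝕜] {X : Type*} [NormedAddCommGroup X] [NormedSpace 𝕜 X]

theorem sum_map_range' {M : Type*} [AddCommMonoid M] (f : ℕ → M) (a n : ℕ) :
    ((List.range' a n).map f).sum = ∑ i ∈ Finset.range n, f (a + i) := by
  induction n with
  | zero => simp
  | succ n ih => simp [List.range'_concat, Finset.sum_range_succ, ih]

theorem comb_replicate_one (x : ℕ → X) (n : ℕ) (t : List ℕ) (ht : t.length = n) :
    comb x (List.replicate n (1 : 𝕜)) t = (t.map x).sum := by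
  induction t generalizing n with
  | nil => simp
  | cons m t ih =>
    subst ht
    simp [List.replicate_succ, ih t.length rfl]

theorem comb_flatMap (x : ℕ → X) (l : List ℕ) (f : ℕ → List 𝕜) (g : ℕ → List ℕ)
    (h : ∀ j, (f j).length = (g j).length) :
    comb x (l.flatMap f) (l.flatMap g) = (l.map fun j => comb x (f j) (g j)).sum := by
  induction l with
  | nil => simp
  | cons j l ih => simp [comb_append x (h j), ih]

theorem map_comb {Y : Type*} [NormedAddCommGroup Y] [NormedSpace 𝕜 Y] (g : X →L[𝕜] Y)
    (x : ℕ → X) (β : List 𝕜) (t : List ℕ) : g (comb x β t) = comb (g ∘ x) β t := by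
  induction β generalizing t with
  | nil => simp
  | cons b β ih => cases t <;> simp [ih]

end Lists

/-! ### Small means in the spreading model give Cesàro null subsequences -/

section CesaroNull

variable {𝕜 : Type*} [RCLike 𝕜] {X : Type*} [NormedAddCommGroup X] [NormedSpace 𝕜 X]

theorem norm_cesaroMean (y : ℕ → X) (N : ℕ) :
    ‖cesaroMean 𝕜 y N‖ = ((N : ℝ) + 1)⁻¹ * ‖∑ i ∈ Finset.range (N + 1), y i‖ := by
  have : ((N : 𝕜) + 1) = (((N : ℝ) + 1 : ℝ) : 𝕜) := by push_cast; rfl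
  rw [cesaroMean, norm_smul, norm_inv, this, RCLike.norm_ofReal, abs_of_pos (by positivity)]

/-- Blocks of length `n` are peeled off from the right until at most `J + n` terms remain, and these
are bounded trivially. -/
theorem norm_sum_range_le_of_blocks {y : ℕ → X} {C ρ : ℝ} {J n : ℕ} (hn : 0 < n) (hρ : 0 ≤ ρ)
    (hC : ∀ i, ‖y i‖ ≤ C)
    (hy : ∀ a, J ≤ a → ‖∑ i ∈ Finset.range n, y (a + i)‖ ≤ n * ρ) (N : ℕ) :
    ‖∑ i ∈ Finset.range N, y i‖ ≤ (J + n) * C + N * ρ := by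
  have hC0 : 0 ≤ C := (norm_nonneg _).trans (hC 0)
  induction N using Nat.strong_induction_on with
  | _ N ih =>
    rcases le_or_gt N (J + n) with h | h
    · have h1 : ‖∑ i ∈ Finset.range N, y i‖ ≤ N * C := by
        simpa using norm_sum_le_of_le (Finset.range N) fun i _ => hC i
      have h2 : (N : ℝ) ≤ J + n := by exact_mod_cast h
      have h3 : (N : ℝ) * C ≤ (J + n) * C := by gcongr
      have h4 : 0 ≤ (N : ℝ) * ρ := by positivity
      linarith
    · obtain ⟨M, rfl⟩ : ∃ M, N = M + n := ⟨N - n, by omega⟩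
      rw [Finset.sum_range_add]
      have h1 := ih M (by omega)
      have h2 := hy M (by omega)
      refine (norm_add_le _ _).trans ?_
      push_cast
      linarith

/-- If the spreading norm of the means `(e₁ + ⋯ + e_n) / n` is not bounded below then some
subsequence is Cesàro convergent to `0`. -/
theorem exists_cesaroMean_tendsto_zero {x : ℕ → X} {C : ℝ} (hC : ∀ n, ‖x n‖ ≤ C)
    (h : ∀ δ > 0, ∃ n : ℕ, spreadNorm x (List.replicate n (1 : 𝕜)) 0 < δ * n) :
    ∃ φ : ℕ → ℕ, StrictMono φ ∧ Tendsto (cesaroMean 𝕜 (x ∘ φ)) atTop (𝓝 0) := by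
  have h' : ∀ j : ℕ, ∃ n : ℕ, spreadNorm x (List.replicate n (1 : 𝕜)) 0 < 1 / ((j : ℝ) + 1) * n :=
    fun j => h _ (by positivity)
  choose n hn using h'
  have hn0 : ∀ j, 0 < n j := fun j => by
    rcases Nat.eq_zero_or_pos (n j) with h0 | h0
    · have := hn j
      simp [h0] at this
    · exact h0
  obtain ⟨φ, hφ, hφt⟩ := exists_strictMono_norm_comb_near (𝕜 := 𝕜) hC
    (fun j => List.replicate (n j) (1 : 𝕜)) (ε := fun j => 1 / ((j : ℝ) + 1))
    fun j => by positivity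
  refine ⟨φ, hφ, ?_⟩
  have hC' : ∀ i, ‖(x ∘ φ) i‖ ≤ C := fun i => hC _
  have hblock : ∀ j a, j ≤ a →
      ‖∑ i ∈ Finset.range (n j), (x ∘ φ) (a + i)‖ ≤ n j * (2 / ((j : ℝ) + 1)) := by
    intro j a hja
    have h1 := hφt j (List.range' a (n j)) List.pairwise_lt_range'
      (fun i hi => hja.trans (List.mem_range'_1.1 hi).1) (by simp)
    rw [comb_replicate_one _ _ _ (by simp), sum_map_range'] at h1
    have h2 := (abs_lt.1 h1).2
    have h3 : (1 : ℝ) ≤ n j := by exact_mod_cast hn0 j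
    have h4 : 1 / ((j : ℝ) + 1) ≤ n j * (1 / ((j : ℝ) + 1)) :=
      le_mul_of_one_le_left (by positivity) h3
    have h5 := hn j
    calc _ ≤ n j * (1 / ((j : ℝ) + 1)) + n j * (1 / ((j : ℝ) + 1)) := by linarith
      _ = _ := by ring
  rw [tendsto_zero_iff_norm_tendsto_zero, Metric.tendsto_atTop]
  intro ε hε
  -- The blocks of length `n j` contribute at most `2 / (j + 1) ≤ ε / 2` to the mean; then `N₀`
  -- makes the uncontrolled initial part contribute less than `ε / 2`.
  obtain ⟨j, hj⟩ := exists_nat_gt (4 / ε)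
  obtain ⟨N₀, hN₀⟩ := exists_nat_gt ((j + n j) * C / (ε / 2))
  refine ⟨N₀, fun N hN => ?_⟩
  rw [Real.dist_0_eq_abs, abs_norm, norm_cesaroMean, inv_mul_lt_iff₀ (by positivity)]
  have h1 := norm_sum_range_le_of_blocks (hn0 j) (by positivity) hC' (hblock j) (N + 1)
  have h2 : 2 / ((j : ℝ) + 1) ≤ ε / 2 := by
    rw [div_lt_iff₀ hε] at hj
    rw [div_le_div_iff₀ (by positivity) (by norm_num)]
    linarith
  have h3 : ((N + 1 : ℕ) : ℝ) * (2 / ((j : ℝ) + 1)) ≤ (N + 1) * (ε / 2) := by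
    push_cast; gcongr
  rw [div_lt_iff₀ (by positivity)] at hN₀
  have h4 : (N₀ : ℝ) ≤ N := by exact_mod_cast hN
  nlinarith

end CesaroNull

/-! ### Elementary facts on `ca`, `bs`, `wbs` and weak convergence -/

section Quantities

variable {𝕜 : Type*} [RCLike 𝕜] {X : Type*} [NormedAddCommGroup X] [NormedSpace 𝕜 X]

theorem le_ca {x : ℕ → X} {r : ℝ} (h : ∀ n, ∃ k ≥ n, ∃ l ≥ n, r ≤ ‖x k - x l‖) :
    ENNReal.ofReal r ≤ ca x := by
  refine le_iInf fun n => ?_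
  obtain ⟨k, hk, l, hl, hr⟩ := h n
  refine le_trans ?_ (le_iSup_of_le k <| le_iSup_of_le l <| le_iSup_of_le hk <|
    le_iSup_of_le hl le_rfl)
  rw [← ofReal_norm]
  exact ENNReal.ofReal_le_ofReal hr

theorem ca_eq_zero_of_tendsto {x : ℕ → X} {l : X} (h : Tendsto x atTop (𝓝 l)) : ca x = 0 := by
  refine le_antisymm (ENNReal.le_of_forall_pos_le_add fun ε hε _ => ?_) zero_le
  obtain ⟨n, hn⟩ := Metric.cauchySeq_iff.1 h.cauchySeq ε (by exact_mod_cast hε)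
  refine iInf_le_of_le n (iSup_le fun k => iSup_le fun l => iSup_le fun hk => iSup_le fun hl => ?_)
  have := hn k hk l hl
  rw [dist_eq_norm] at this
  rw [zero_add, ← ofReal_norm, ← ENNReal.ofReal_coe_nnreal]
  exact ENNReal.ofReal_le_ofReal this.le

theorem norm_cesaroMean_le {x : ℕ → X} {C : ℝ} (hx : ∀ n, ‖x n‖ ≤ C) (k : ℕ) :
    ‖cesaroMean 𝕜 x k‖ ≤ C := by
  rw [norm_cesaroMean, inv_mul_le_iff₀ (by positivity)]
  simpa using norm_sum_le_of_le (Finset.range (k + 1)) fun i _ => hx i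

theorem bs_closedBall_le : bs 𝕜 (Metric.closedBall (0 : X) 1) ≤ 2 := by
  refine iSup_le fun x => iSup_le fun hx => ?_
  refine iInf_le_of_le id (iInf_le_of_le strictMono_id (iInf_le_of_le 0 ?_))
  refine iSup_le fun k => iSup_le fun l => iSup_le fun _ => iSup_le fun _ => ?_
  have hx' : ∀ n, ‖(x ∘ id) n‖ ≤ 1 := fun n => by simpa using hx n
  have h : ‖cesaroMean 𝕜 (x ∘ id) k - cesaroMean 𝕜 (x ∘ id) l‖ ≤ 2 := by
    have h1 := norm_cesaroMean_le (𝕜 := 𝕜) hx' k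
    have h2 := norm_cesaroMean_le (𝕜 := 𝕜) hx' l
    linarith [norm_sub_le (cesaroMean 𝕜 (x ∘ id) k) (cesaroMean 𝕜 (x ∘ id) l)]
  rw [← ofReal_norm]
  simpa using ENNReal.ofReal_le_ofReal h

theorem wbs_le_bs (A : Set X) : wbs 𝕜 A ≤ bs 𝕜 A :=
  iSup_mono fun _ => iSup_mono fun _ => iSup_le fun _ => le_rfl

theorem tendsto_toWeakSpace_iff {ι : Type*} {l : Filter ι} {x : ι → X} {a : X} :
    Tendsto (fun n => toWeakSpace 𝕜 X (x n)) l (𝓝 (toWeakSpace 𝕜 X a)) ↔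
      ∀ g : StrongDual 𝕜 X, Tendsto (fun n => g (x n)) l (𝓝 (g a)) := by
  have hinj : Function.Injective (topDualPairing 𝕜 X).flip := fun v w h => by
    by_contra hne
    obtain ⟨g, hg⟩ := SeparatingDual.exists_separating_of_ne (R := 𝕜) hne
    exact hg (by simpa using LinearMap.congr_fun h g)
  exact WeakBilin.tendsto_iff_forall_eval_tendsto _ hinj

theorem WeaklyNull.isWeaklyConvergent {x : ℕ → X} (hx : WeaklyNull 𝕜 x) :
    IsWeaklyConvergent 𝕜 x :=
  ⟨0, tendsto_toWeakSpace_iff.2 fun g => by simpa using hx g⟩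

end Quantities

/-! ### James' distortion argument and the criterion for the value 2 -/

section Distortion

variable {𝕜 : Type*} [RCLike 𝕜] {X : Type*} [NormedAddCommGroup X] [NormedSpace 𝕜 X]

/-- The coefficients expressing the difference of the means of the first `K` and of the first `L`
terms of a sequence. -/
noncomputable def meanDiffCoeff (K L j : ℕ) : ℝ :=
  (if j < K then (K : ℝ)⁻¹ else 0) - (L : ℝ)⁻¹

/-- The coefficients are `1/K - 1/L` on `K` places and `-1/L` on `L - K` places. This is the source
of the constant 2: the `ℓ¹`-distance of two means tends to 2 as `K / L → 0`. -/
theorem sum_abs_meanDiffCoeff {K L : ℕ} (hK : 0 < K) (hKL : K ≤ L) :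
    ∑ j ∈ Finset.range L, |meanDiffCoeff K L j| = 2 - 2 * (K / L : ℝ) := by
  obtain ⟨M, rfl⟩ := Nat.exists_eq_add_of_le hKL
  have hK' : (0 : ℝ) < K := by exact_mod_cast hK
  have hinv : ((K + M : ℕ) : ℝ)⁻¹ ≤ (K : ℝ)⁻¹ := by
    gcongr
  rw [Finset.sum_range_add]
  have h1 : ∀ j ∈ Finset.range K, |meanDiffCoeff K (K + M) j| =
      (K : ℝ)⁻¹ - ((K + M : ℕ) : ℝ)⁻¹ := fun j hj => by
    rw [meanDiffCoeff, if_pos (Finset.mem_range.1 hj), abs_of_nonneg (by linarith)]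
  have h2 : ∀ j ∈ Finset.range M, |meanDiffCoeff K (K + M) (K + j)| = ((K + M : ℕ) : ℝ)⁻¹ :=
    fun j _ => by
      rw [meanDiffCoeff, if_neg (by omega), zero_sub, abs_neg, abs_of_nonneg (by positivity)]
  rw [Finset.sum_congr rfl h1, Finset.sum_congr rfl h2]
  simp only [Finset.sum_const, Finset.card_range, nsmul_eq_mul]
  push_cast
  field_simp
  ring

theorem abs_meanDiffCoeff_le {K L : ℕ} (hK : 0 < K) (hKL : K ≤ L) {j : ℕ} (hj : j < K) :
    |meanDiffCoeff K L j| ≤ (K : ℝ)⁻¹ := by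
  have hK' : (0 : ℝ) < K := by exact_mod_cast hK
  have hinv : (L : ℝ)⁻¹ ≤ (K : ℝ)⁻¹ := by gcongr
  have h0 : (0 : ℝ) ≤ (L : ℝ)⁻¹ := by positivity
  rw [meanDiffCoeff, if_pos hj, abs_of_nonneg (by linarith)]
  linarith

theorem cesaroMean_sub_cesaroMean (v : ℕ → X) {K L : ℕ} (hK : 0 < K) (hKL : K ≤ L) :
    cesaroMean 𝕜 v (K - 1) - cesaroMean 𝕜 v (L - 1) =
      ∑ j ∈ Finset.range L, ((meanDiffCoeff K L j : ℝ) : 𝕜) • v j := by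
  have e : ∀ N : ℕ, 0 < N → cesaroMean 𝕜 v (N - 1) = ((N : 𝕜))⁻¹ • ∑ i ∈ Finset.range N, v i :=
    fun N hN => by
      obtain ⟨M, rfl⟩ : ∃ M, N = M + 1 := ⟨N - 1, by omega⟩
      simp [cesaroMean]
  rw [e K hK, e L (hK.trans_le hKL), Finset.smul_sum, Finset.smul_sum]
  have h1 : ∑ i ∈ Finset.range K, (K : 𝕜)⁻¹ • v i =
      ∑ i ∈ Finset.range L, (if i < K then (K : 𝕜)⁻¹ else 0) • v i := by
    obtain ⟨M, rfl⟩ := Nat.exists_eq_add_of_le hKL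
    rw [Finset.sum_range_add]
    have : ∑ j ∈ Finset.range M, (if K + j < K then (K : 𝕜)⁻¹ else 0) • v (K + j) = 0 :=
      Finset.sum_eq_zero fun j _ => by simp
    rw [this, add_zero]
    refine Finset.sum_congr rfl fun j hj => ?_
    rw [if_pos (Finset.mem_range.1 hj)]
  rw [h1, ← Finset.sum_sub_distrib]
  refine Finset.sum_congr rfl fun j _ => ?_
  rw [← sub_smul, meanDiffCoeff]
  congr 1
  split_ifs <;> simp

theorem sum_range_eq_add_sum_range {M : Type*} [AddCommMonoid M] {k n : ℕ} (h : k ≤ n)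
    (f : ℕ → M) : ∑ j ∈ Finset.range n, f j =
      ∑ j ∈ Finset.range k, f j + ∑ i ∈ Finset.range (n - k), f (k + i) := by
  rw [← Finset.sum_range_add, Nat.add_sub_cancel' h]

theorem tendsto_comb_zero {y : ℕ → 𝕜} (hy : Tendsto y atTop (𝓝 0)) (a : List 𝕜) {s : ℕ → ℕ}
    (hs : Tendsto s atTop atTop) :
    Tendsto (fun j => comb y a (List.range' (s j) a.length)) atTop (𝓝 0) := by
  induction a generalizing s with
  | nil => simp
  | cons b a ih =>
    simp only [List.length_cons, List.range'_succ, comb_cons]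
    have h1 := (hy.comp hs).const_smul b
    have h2 := ih (s := fun j => s j + 1) ((tendsto_add_atTop_nat 1).comp hs)
    have h3 := h1.add h2
    rw [smul_zero, add_zero] at h3
    exact h3

theorem pairwise_lt_flatMap_blocks {ψ : ℕ → ℕ} (hψ : StrictMono ψ) (m k n : ℕ) :
    ((List.range' k n).flatMap fun j => List.range' (m * ψ j) m).Pairwise (· < ·) := by
  rw [List.pairwise_flatMap]
  refine ⟨fun j _ => List.pairwise_lt_range', ?_⟩
  refine (List.pairwise_lt_range' (s := k) (n := n) (step := 1)).imp fun {i j} hij p hp q hq => ?_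
  rw [List.mem_range'_1] at hp hq
  have h1 : ψ i + 1 ≤ ψ j := hψ hij
  have h2 : m * (ψ i + 1) ≤ m * ψ j := Nat.mul_le_mul_left m h1
  rw [mul_add, mul_one] at h2
  omega

theorem sum_norm_flatMap (l : List ℕ) (w : ℕ → ℝ) (a : List 𝕜) (ha : (a.map norm).sum = 1) :
    ((l.flatMap fun j => a.map (((w j : ℝ) : 𝕜) * ·)).map norm).sum =
      (l.map fun j => |w j|).sum := by
  induction l with
  | nil => simp
  | cons j l ih =>
    rw [List.flatMap_cons, List.map_append, List.sum_append, ih, List.map_cons, List.sum_cons,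
      List.map_map]
    congr 1
    have : (a.map (norm ∘ (((w j : ℝ) : 𝕜) * ·))) = a.map fun b => |w j| * ‖b‖ :=
      List.map_congr_left fun b _ => by simp
    rw [this, List.sum_map_mul_left, ha, mul_one]

/-- James' distortion argument for spreading models: if the spreading model of a weakly null
sequence is isomorphic to `ℓ¹`, then blocks of the sequence generate a spreading model nearly
isometric to `ℓ¹`. -/
theorem exists_weaklyNull_lt_tcca {x : ℕ → X} {C : ℝ} (hC : ∀ n, ‖x n‖ ≤ C)
    (hx : WeaklyNull 𝕜 x) {c₀ : ℝ} (hc₀ : 0 < c₀)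
    (h : ∀ as : List 𝕜, c₀ * (as.map norm).sum ≤ spreadNorm x as 0) {r : ℝ} (hr0 : 0 ≤ r)
    (hr : r < 2) :
    ∃ z : ℕ → X, (∀ n, ‖z n‖ ≤ 1) ∧ WeaklyNull 𝕜 z ∧ ENNReal.ofReal r ≤ tcca 𝕜 z := by
  -- The infimum `c` of the spreading norm over the `ℓ¹`-sphere is the best lower constant. A near
  -- minimiser `a` gives blocks of norm about `c`, while any combination of such blocks is still
  -- bounded below with the constant `c`.
  set S : Set ℝ := (fun as : List 𝕜 => spreadNorm x as 0) '' {as | (as.map norm).sum = 1} with hS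
  have hSne : S.Nonempty := ⟨_, [1], by simp, rfl⟩
  have hSlb : ∀ s ∈ S, c₀ ≤ s := by
    rintro _ ⟨as, has, rfl⟩
    have has' : (as.map norm).sum = 1 := has
    simpa [has'] using h as
  have hSbdd : BddBelow S := ⟨c₀, hSlb⟩
  set c := sInf S with hc
  have hcpos : 0 < c := hc₀.trans_le (le_csInf hSne hSlb)
  have hcle : ∀ as : List 𝕜, c * (as.map norm).sum ≤ spreadNorm x as 0 := by
    intro as
    rcases eq_or_lt_of_le (List.sum_nonneg (l := as.map norm) (by simp)) with h0 | h0
    · rw [← h0, mul_zero]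
      exact (spreadNorm_mem_Icc hC as 0).1
    · set σ := (as.map norm).sum
      have h1 : ((as.map (((σ⁻¹ : ℝ) : 𝕜) * ·)).map norm).sum = 1 := by
        rw [List.map_map]
        have : (as.map (norm ∘ (((σ⁻¹ : ℝ) : 𝕜) * ·))) = as.map fun b => σ⁻¹ * ‖b‖ :=
          List.map_congr_left fun b _ => by simp [abs_of_pos h0]
        rw [this, List.sum_map_mul_left]
        exact inv_mul_cancel₀ h0.ne'
      have h2 : c ≤ spreadNorm x (as.map (((σ⁻¹ : ℝ) : 𝕜) * ·)) 0 := csInf_le hSbdd ⟨_, h1, rfl⟩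
      rw [spreadNorm_smul_zero hC, RCLike.norm_ofReal, abs_of_pos (by positivity)] at h2
      rw [inv_mul_eq_div, le_div_iff₀ h0] at h2
      exact h2
  -- The witness solves `r * (c + 2 * η) = 2 * c - 2 * η`: blocks will have norm at most `c + 2 *
  -- η`, and differences of means norm at least `2 * c - 2 * η`.
  obtain ⟨η, hη, hηr⟩ : ∃ η > 0, r * (c + 2 * η) ≤ 2 * c - 2 * η := by
    refine ⟨c * (2 - r) / (2 + 2 * r), ?_, le_of_eq ?_⟩
    · have : 0 < 2 - r := by linarith
      positivity
    · field_simp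
      ring
  obtain ⟨_, ⟨a, ha, rfl⟩, hac⟩ := exists_lt_of_csInf_lt hSne (show sInf S < c + η by linarith)
  have ha1 : (a.map norm).sum = 1 := ha
  set m := a.length with hm
  have hmpos : 0 < m := List.length_pos_iff.2 (by rintro rfl; simp at ha1)
  set w : ℕ → ℕ → ℝ := fun k => meanDiffCoeff (k ^ 2) (k ^ 4) with hw
  -- `β 0` controls the norm of a single block. `β k` is the difference of the means of `k ^ 2` and
  -- `k ^ 4` blocks, without the first `k` of them, because the extraction controls only indices
  -- from `k` on.
  set β : ℕ → List 𝕜 := fun k => if k = 0 then a else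
    (List.range' k (k ^ 4 - k)).flatMap fun j => a.map (((w k j : ℝ) : 𝕜) * ·) with hβ
  obtain ⟨φ, hφ, hφt⟩ := exists_strictMono_norm_comb_near hC β (ε := fun _ => η) fun _ => hη
  set y := x ∘ φ with hy
  set z : ℕ → X := fun j => comb y a (List.range' (m * j) m) with hz
  set B := c + 2 * η with hB
  have hBpos : 0 < B := by positivity
  have hzB : ∀ j, ‖z j‖ ≤ B := fun j => by
    have h1 := hφt 0 (List.range' (m * j) m) List.pairwise_lt_range' (by simp)
      (by simp [hβ, hm])
    have h2 := (abs_lt.1 h1).2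
    simp only [hβ, if_true] at h2
    simp only [hz, hB]
    linarith
  have hznull : WeaklyNull 𝕜 z := fun g => by
    have h1 : Tendsto (g ∘ y) atTop (𝓝 0) := (hx g).comp hφ.tendsto_atTop
    have h2 := tendsto_comb_zero h1 a (s := fun j => m * j)
      (tendsto_id.const_mul_atTop' hmpos)
    refine h2.congr fun j => ?_
    rw [hz, map_comb]
  -- The bound is uniform in `ψ`: a subsequence of blocks uses the same coefficients `β k` at other
  -- increasing indices, and the spreading norm does not see the indices.
  have hdiff : ∀ ψ : ℕ → ℕ, StrictMono ψ → ∀ k : ℕ, 2 ≤ k →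
      2 * c - η - (3 * c + B) / k ≤
        ‖cesaroMean 𝕜 (z ∘ ψ) (k ^ 2 - 1) - cesaroMean 𝕜 (z ∘ ψ) (k ^ 4 - 1)‖ := by
    intro ψ hψ k hk
    have hk0 : k ≠ 0 := by omega
    have hkpos : (0 : ℝ) < k := by exact_mod_cast (by omega : 0 < k)
    have hk1 : (1 : ℝ) ≤ k := by exact_mod_cast (by omega : 1 ≤ k)
    have hK : 0 < k ^ 2 := by positivity
    have hkK : k ≤ k ^ 2 := Nat.le_self_pow two_ne_zero k
    have hKL : k ^ 2 ≤ k ^ 4 := Nat.pow_le_pow_right (by omega) (by norm_num)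
    have hk4 : k ≤ k ^ 4 := hkK.trans hKL
    -- The first `k` blocks have weights at most `k⁻²`, so they cost `B / k` in norm and `1 / k` in
    -- `ℓ¹`-mass. With `2 * K / L ≤ 2 / k` the remaining mass is at least `2 - 3 / k`.
    rw [cesaroMean_sub_cesaroMean _ hK hKL, sum_range_eq_add_sum_range hk4]
    have hfirst : ∀ j ∈ Finset.range k, |w k j| ≤ ((k : ℝ) ^ 2)⁻¹ := fun j hj => by
      have := abs_meanDiffCoeff_le hK hKL ((Finset.mem_range.1 hj).trans_le hkK)
      exact_mod_cast this
    have h1 : ‖∑ j ∈ Finset.range k, ((w k j : ℝ) : 𝕜) • (z ∘ ψ) j‖ ≤ B / k := by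
      have : ∀ j ∈ Finset.range k, ‖((w k j : ℝ) : 𝕜) • (z ∘ ψ) j‖ ≤ ((k : ℝ) ^ 2)⁻¹ * B :=
        fun j hj => by
          rw [norm_smul, RCLike.norm_ofReal]
          exact mul_le_mul (hfirst j hj) (hzB _) (norm_nonneg _) (by positivity)
      refine (norm_sum_le_of_le _ this).trans (le_of_eq ?_)
      rw [Finset.sum_const, Finset.card_range, nsmul_eq_mul]
      field_simp
    have h2 : ∑ j ∈ Finset.range k, |w k j| ≤ 1 / k := by
      refine (Finset.sum_le_sum hfirst).trans (le_of_eq ?_)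
      rw [Finset.sum_const, Finset.card_range, nsmul_eq_mul]
      field_simp
    have h3 := sum_abs_meanDiffCoeff hK hKL
    rw [sum_range_eq_add_sum_range hk4] at h3
    have h4 : ((k ^ 2 : ℕ) : ℝ) / ((k ^ 4 : ℕ) : ℝ) ≤ 1 / k := by
      push_cast
      rw [div_le_div_iff₀ (by positivity) hkpos]
      have : (k : ℝ) ^ 3 ≤ k ^ 4 := pow_le_pow_right₀ hk1 (by norm_num)
      nlinarith
    set t := (List.range' k (k ^ 4 - k)).flatMap fun j => List.range' (m * ψ j) m with ht
    have h5 : comb y (β k) t =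
        ∑ i ∈ Finset.range (k ^ 4 - k), ((w k (k + i) : ℝ) : 𝕜) • (z ∘ ψ) (k + i) := by
      simp only [hβ, if_neg hk0, ht]
      rw [comb_flatMap _ _ _ _ (by simp [hm]), sum_map_range']
      exact Finset.sum_congr rfl fun i _ => by rw [comb_smul]; rfl
    have h6 := hφt k t (pairwise_lt_flatMap_blocks hψ m k _) (fun i hi => by
        obtain ⟨j, hj, hij⟩ := List.mem_flatMap.1 hi
        rw [List.mem_range'_1] at hj hij
        have e1 : j ≤ ψ j := hψ.le_apply
        have e2 : ψ j ≤ m * ψ j := Nat.le_mul_of_pos_left _ hmpos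
        omega) (by simp [hβ, if_neg hk0, ht, List.length_flatMap, hm])
    rw [h5] at h6
    have h7 := hcle (β k)
    have h8 : ((β k).map norm).sum = ∑ i ∈ Finset.range (k ^ 4 - k), |w k (k + i)| := by
      simp only [hβ, if_neg hk0]
      rw [sum_norm_flatMap _ _ _ ha1, sum_map_range']
    rw [h8] at h7
    have h9 := (abs_lt.1 h6).1
    have h10 : 2 - 3 * (1 / (k : ℝ)) ≤ ∑ i ∈ Finset.range (k ^ 4 - k), |w k (k + i)| := by
      linarith
    have h11 := mul_le_mul_of_nonneg_left h10 hcpos.le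
    have h12 := norm_sub_le_norm_add
      (∑ i ∈ Finset.range (k ^ 4 - k), ((w k (k + i) : ℝ) : 𝕜) • (z ∘ ψ) (k + i))
      (∑ j ∈ Finset.range k, ((w k j : ℝ) : 𝕜) • (z ∘ ψ) j)
    rw [add_comm (∑ i ∈ Finset.range (k ^ 4 - k), _)] at h12
    have h13 : (3 * c + B) / k = c * (3 * (1 / (k : ℝ))) + B / k := by ring
    rw [h13]
    linarith
  refine ⟨fun j => ((B⁻¹ : ℝ) : 𝕜) • z j, fun j => ?_, fun g => ?_, ?_⟩
  · rw [norm_smul, RCLike.norm_ofReal, abs_of_pos (by positivity), inv_mul_le_iff₀ hBpos, mul_one]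
    exact hzB j
  · simpa using (hznull g).const_mul ((B⁻¹ : ℝ) : 𝕜)
  · refine le_iInf fun ψ => le_iInf fun hψ => le_ca fun n => ?_
    obtain ⟨k₀, hk₀⟩ := exists_nat_gt ((3 * c + B) / η)
    set k := max k₀ (n + 2) with hk
    have hk2 : 2 ≤ k := by omega
    have hkn : n + 1 ≤ k := by omega
    have hkpos : (0 : ℝ) < k := by exact_mod_cast (by omega : 0 < k)
    have e1 : k ≤ k ^ 2 := Nat.le_self_pow two_ne_zero k
    have e2 : k ≤ k ^ 4 := Nat.le_self_pow four_ne_zero k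
    -- Entry `K - 1` of `cesaroMean` averages `K` terms.
    refine ⟨k ^ 2 - 1, by omega, k ^ 4 - 1, by omega, ?_⟩
    have h1 : ∀ N, cesaroMean 𝕜 ((fun j => ((B⁻¹ : ℝ) : 𝕜) • z j) ∘ ψ) N =
        ((B⁻¹ : ℝ) : 𝕜) • cesaroMean 𝕜 (z ∘ ψ) N := fun N => by
      simp only [cesaroMean, Function.comp_apply]
      rw [← Finset.smul_sum, smul_comm]
    rw [h1, h1, ← smul_sub, norm_smul, RCLike.norm_ofReal, abs_of_pos (by positivity),
      inv_mul_eq_div, le_div_iff₀ hBpos]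
    have h2 := hdiff ψ hψ k hk2
    have h3 : (3 * c + B) / k ≤ η := by
      rw [div_le_iff₀ hkpos]
      rw [div_lt_iff₀ hη] at hk₀
      have : (k₀ : ℝ) ≤ k := by exact_mod_cast le_max_left _ _
      nlinarith
    linarith

/-- A weakly null sequence without subsequences that are Cesàro convergent to `0` forces the
weak Banach-Saks quantity of the unit ball to be maximal. -/
theorem wbs_eq_two_of_weaklyNull {x : ℕ → X} {C : ℝ} (hC : ∀ n, ‖x n‖ ≤ C)
    (hx : WeaklyNull 𝕜 x)
    (hces : ∀ φ : ℕ → ℕ, StrictMono φ → ¬ Tendsto (cesaroMean 𝕜 (x ∘ φ)) atTop (𝓝 0)) :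
    wbs 𝕜 (Metric.closedBall (0 : X) 1) = 2 := by
  have hδ : ∃ δ > 0, ∀ n : ℕ, δ * n ≤ spreadNorm x (List.replicate n (1 : 𝕜)) 0 := by
    by_contra! hne
    obtain ⟨φ, hφ, hφ0⟩ := exists_cesaroMean_tendsto_zero hC hne
    exact hces φ hφ hφ0
  obtain ⟨δ, hδ0, hδ⟩ := hδ
  obtain ⟨c₀, hc₀, hc⟩ := exists_pos_mul_le_spreadNorm hC hx hδ0 hδ
  refine le_antisymm ((wbs_le_bs _).trans bs_closedBall_le) (le_of_forall_lt fun r hr => ?_)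
  obtain ⟨s, hrs, hs2⟩ := exists_between hr
  have hs_top : s ≠ ⊤ := ne_top_of_lt hs2
  obtain ⟨z, hz1, hz, hzt⟩ := exists_weaklyNull_lt_tcca hC hx hc₀ hc
    (r := s.toReal) ENNReal.toReal_nonneg (by
      have := (ENNReal.toReal_lt_toReal hs_top (by simp)).2 hs2
      simpa using this)
  rw [ENNReal.ofReal_toReal hs_top] at hzt
  refine hrs.trans_le (hzt.trans ?_)
  exact le_iSup_of_le z <| le_iSup_of_le (fun n => by simpa using hz1 n) <|
    le_iSup_of_le hz.isWeaklyConvergent le_rfl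

theorem bs_eq_two_of_wbs_eq_two (h : wbs 𝕜 (Metric.closedBall (0 : X) 1) = 2) :
    bs 𝕜 (Metric.closedBall (0 : X) 1) = 2 :=
  le_antisymm bs_closedBall_le (h ▸ wbs_le_bs _)

end Distortion

/-! ### Weakly compact sets and the dichotomy -/

section WeakCompactness

variable {𝕜 : Type*} [RCLike 𝕜] {X : Type*} [NormedAddCommGroup X] [NormedSpace 𝕜 X]

theorem continuous_eval_weakSpace (f : StrongDual 𝕜 X) :
    Continuous fun w : WeakSpace 𝕜 X => f ((toWeakSpace 𝕜 X).symm w) :=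
  WeakBilin.eval_continuous (topDualPairing 𝕜 X).flip f

/-- Uniform boundedness on the dual, which is complete whether or not `X` is. -/
theorem isBounded_of_isCompact_weak {K : Set X} (hK : IsCompact (toWeakSpace 𝕜 X '' K)) :
    Bornology.IsBounded K := by
  obtain ⟨C, hC⟩ := banach_steinhaus
    (g := fun k : K => NormedSpace.inclusionInDoubleDual 𝕜 X (k : X)) (by
      intro f
      obtain ⟨C, hC⟩ := (hK.image (continuous_eval_weakSpace f)).isBounded.exists_norm_le
      exact ⟨C, fun k => hC _ ⟨_, ⟨k, k.2, rfl⟩, rfl⟩⟩)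
  refine isBounded_iff_forall_norm_le.2 ⟨C, fun k hk => ?_⟩
  rw [← (NormedSpace.inclusionInDoubleDualLi 𝕜 (E := X)).norm_map k]
  exact hC ⟨k, hk⟩

/-- Norming functionals of a dense sequence suffice: if `f n y = 0`, then `‖d n‖ = ‖f n (d n - y)‖ ≤
‖y - d n‖`, which is impossible for `d n` within `‖y‖ / 2` of `y ≠ 0`. -/
theorem exists_countable_separating_functionals {Y : Set X} (hY : TopologicalSpace.IsSeparable Y) :
    ∃ (ι : Type) (_ : Countable ι) (f : ι → StrongDual 𝕜 X),
      ∀ y ∈ Y, (∀ i, f i y = 0) → y = 0 := by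
  obtain ⟨c, hc, hYc⟩ := hY
  rcases c.eq_empty_or_nonempty with rfl | hne
  · exact ⟨ℕ, inferInstance, fun _ => 0, fun y hy => by simpa using hYc hy⟩
  obtain ⟨d, rfl⟩ := hc.exists_eq_range hne
  choose f hf1 hf2 using fun n => exists_dual_vector'' 𝕜 (d n)
  refine ⟨ℕ, inferInstance, f, fun y hy h0 => ?_⟩
  by_contra hy0
  obtain ⟨_, ⟨n, rfl⟩, hn⟩ := Metric.mem_closure_iff.1 (hYc hy) (‖y‖ / 2)
    (half_pos (norm_pos_iff.2 hy0))
  rw [dist_eq_norm] at hn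
  have h1 : ‖d n‖ ≤ ‖y - d n‖ := by
    have : ((‖d n‖ : ℝ) : 𝕜) = f n (d n - y) := by rw [map_sub, h0, sub_zero, hf2]
    calc ‖d n‖ = ‖((‖d n‖ : ℝ) : 𝕜)‖ := by simp
      _ ≤ 1 * ‖d n - y‖ := by rw [this]; exact (f n).le_of_opNorm_le (hf1 n) _
      _ = ‖y - d n‖ := by rw [one_mul, norm_sub_rev]
  have h2 := norm_le_norm_add_norm_sub (d n) y
  rw [norm_sub_rev] at h2
  linarith

/-- The easy half of the Eberlein-Šmulian theorem: weakly compact sets are weakly sequentially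
compact. -/
theorem exists_subseq_weak_tendsto {K : Set X} (hK : IsCompact (toWeakSpace 𝕜 X '' K))
    {x : ℕ → X} (hx : ∀ n, x n ∈ K) :
    ∃ a : X, ∃ φ : ℕ → ℕ, StrictMono φ ∧
      ∀ g : StrongDual 𝕜 X, Tendsto (fun n => g (x (φ n))) atTop (𝓝 (g a)) := by
  set V : Submodule 𝕜 X := Submodule.span 𝕜 (Set.range x) with hV
  have hYsep : TopologicalSpace.IsSeparable (closure (V : Set X)) :=
    ((Set.countable_range x).isSeparable.span (R := 𝕜)).closure
  obtain ⟨ι, _, f, hf⟩ := exists_countable_separating_functionals (𝕜 := 𝕜) hYsep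
  obtain ⟨C, hC⟩ := (isBounded_of_isCompact_weak hK).exists_norm_le
  have hcomp : IsCompact (Set.univ.pi fun i => Metric.closedBall (0 : 𝕜) (‖f i‖ * C)) :=
    isCompact_univ_pi fun i => isCompact_closedBall _ _
  obtain ⟨p, -, φ, hφ, hp⟩ := hcomp.tendsto_subseq (x := fun n i => f i (x n)) fun n i _ => by
    rw [mem_closedBall_zero_iff]
    exact ((f i).le_opNorm _).trans (by gcongr; exact hC _ (hx n))
  rw [tendsto_pi_nhds] at hp
  let _ : NormedSpace ℝ X := NormedSpace.restrictScalars ℝ 𝕜 X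
  have : IsScalarTower ℝ 𝕜 X := inferInstance
  -- Weak cluster points stay in the closed span, which is weakly closed by convexity. There the `f
  -- i` separate points, and each `f i` takes the value `p i` at every cluster point; so the cluster
  -- point is unique.
  have hcl : ∀ w : WeakSpace 𝕜 X, MapClusterPt w atTop (fun n => toWeakSpace 𝕜 X (x (φ n))) →
      ∃ b ∈ closure (V : Set X), toWeakSpace 𝕜 X b = w ∧ ∀ i, f i b = p i := by
    intro w hw
    have hconv : Convex ℝ (V : Set X) := (V.restrictScalars ℝ).convex
    have h1 : w ∈ closure (toWeakSpace 𝕜 X '' (V : Set X)) :=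
      isClosed_closure.mem_of_mapClusterPt hw (Eventually.of_forall fun n =>
        subset_closure ⟨_, Submodule.subset_span ⟨_, rfl⟩, rfl⟩)
    rw [← hconv.toWeakSpace_closure 𝕜] at h1
    obtain ⟨b, hb, rfl⟩ := h1
    refine ⟨b, hb, rfl, fun i => ?_⟩
    have h2 := hw.continuousAt_comp (continuous_eval_weakSpace (f i)).continuousAt
    have h3 := hp i
    have h4 : (𝓝 (f i b) ⊓ 𝓝 (p i)).NeBot :=
      NeBot.mono h2 (inf_le_inf_left _ h3)
    exact eq_of_nhds_neBot h4
  obtain ⟨w, hwK, hw⟩ := hK.exists_mapClusterPt (f := atTop)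
    (u := fun n => toWeakSpace 𝕜 X (x (φ n)))
    (le_principal_iff.2 (mem_map.2 (Eventually.of_forall fun n => ⟨_, hx _, rfl⟩)))
  obtain ⟨a, ha, rfl, hfa⟩ := hcl w hw
  refine ⟨a, φ, hφ, tendsto_toWeakSpace_iff.1 ?_⟩
  refine hK.tendsto_nhds_of_unique_mapClusterPt
    (Eventually.of_forall fun n => ⟨_, hx _, rfl⟩) fun w' _ hw' => ?_
  obtain ⟨b, hb, rfl, hfb⟩ := hcl w' hw'
  congr 1
  have hmem : b - a ∈ closure (V : Set X) := V.topologicalClosure.sub_mem hb ha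
  exact sub_eq_zero.1 (hf _ hmem fun i => by rw [map_sub, hfa, hfb, sub_self])

theorem wbs_eq_zero_of_hasWeakBanachSaks (h : HasWeakBanachSaks 𝕜 X) (A : Set X) :
    wbs 𝕜 A = 0 := by
  refine le_antisymm (iSup_le fun x => iSup_le fun _ => iSup_le fun hw => ?_) zero_le
  obtain ⟨l, hl⟩ := hw
  have hK : IsCompact (toWeakSpace 𝕜 X '' insert l (Set.range x)) := by
    rw [Set.image_insert_eq, ← Set.range_comp]
    exact hl.isCompact_insert_range
  obtain ⟨φ, hφ, b, hb⟩ := (h _ hK).2 x fun n => Set.mem_insert_of_mem _ ⟨n, rfl⟩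
  exact iInf_le_of_le φ (iInf_le_of_le hφ (ca_eq_zero_of_tendsto hb).le)

theorem cesaroMean_sub_const (x : ℕ → X) (a : X) (k : ℕ) :
    cesaroMean 𝕜 (fun n => x n - a) k = cesaroMean 𝕜 x k - a := by
  have h : ((k : 𝕜) + 1) ≠ 0 := by exact_mod_cast k.succ_ne_zero
  rw [cesaroMean, cesaroMean, Finset.sum_sub_distrib, smul_sub]
  congr 1
  rw [Finset.sum_const, Finset.card_range, ← Nat.cast_smul_eq_nsmul 𝕜, smul_smul]
  push_cast
  rw [inv_mul_cancel₀ h, one_smul]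

/-- Translating by the weak limit `a` shifts the means by `a`, so a Cesàro null subsequence of `x ∘
φ - a` would make a subsequence of `x` Cesàro convergent. -/
theorem wbs_eq_two_of_not_hasWeakBanachSaks (h : ¬ HasWeakBanachSaks 𝕜 X) :
    wbs 𝕜 (Metric.closedBall (0 : X) 1) = 2 := by
  simp only [HasWeakBanachSaks, IsBanachSaksSet, not_forall, not_and] at h
  obtain ⟨K, hK, h⟩ := h
  have hb := isBounded_of_isCompact_weak hK
  obtain ⟨x, hx, h⟩ := h hb
  push Not at h
  obtain ⟨a, φ, hφ, ha⟩ := exists_subseq_weak_tendsto hK hx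
  obtain ⟨C, hC⟩ := hb.exists_norm_le
  refine wbs_eq_two_of_weaklyNull (𝕜 := 𝕜) (x := fun n => x (φ n) - a) (C := C + ‖a‖)
    (fun n => (norm_sub_le _ _).trans (by gcongr; exact hC _ (hx _))) (fun g => ?_)
    fun ψ hψ h0 => h (φ ∘ ψ) (hφ.comp hψ) ⟨a, ?_⟩
  · simpa using (ha g).sub_const (g a)
  · refine (tendsto_sub_nhds_zero_iff.1 (h0.congr fun k => ?_))
    exact cesaroMean_sub_const (x ∘ φ ∘ ψ) a k

end WeakCompactness

/-! ### Baernstein's norm and its two-sided `ℓ²`-estimates -/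

section BaernsteinGauge

open scoped NNReal

/-- The finitely supported positive functionals norming Baernstein's space: the `ℓ¹`-norm on
Schreier sets, and `ℓ²`-combinations of functionals with successive supports. -/
inductive IsBaernsteinFunctional : (ℕ → ℝ≥0) → Prop
  | indicator (F : Finset ℕ) (hF : ∀ i ∈ F, F.card ≤ i + 1) :
      IsBaernsteinFunctional fun i => if i ∈ F then 1 else 0
  | join (s : ℕ) (a b : ℝ≥0) (hab : a ^ 2 + b ^ 2 ≤ 1) {κ₁ κ₂ : ℕ → ℝ≥0}
      (h₁ : IsBaernsteinFunctional κ₁) (h₂ : IsBaernsteinFunctional κ₂) :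
      IsBaernsteinFunctional fun i => if i < s then a * κ₁ i else b * κ₂ i

/-- Baernstein's norm of a nonnegative sequence. -/
noncomputable def baernsteinGauge (y : ℕ → ℝ≥0∞) : ℝ≥0∞ :=
  ⨆ κ : {κ // IsBaernsteinFunctional κ}, ∑' i, (κ.1 i : ℝ≥0∞) * y i

/-- The first `s` terms of a sequence, continued by `0`. -/
def head (s : ℕ) (y : ℕ → ℝ≥0∞) (i : ℕ) : ℝ≥0∞ := if i < s then y i else 0

/-- The sequence with its first `s` terms replaced by `0`. -/
def tail (s : ℕ) (y : ℕ → ℝ≥0∞) (i : ℕ) : ℝ≥0∞ := if i < s then 0 else y i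

theorem le_baernsteinGauge {κ : ℕ → ℝ≥0} (hκ : IsBaernsteinFunctional κ) (y : ℕ → ℝ≥0∞) :
    ∑' i, (κ i : ℝ≥0∞) * y i ≤ baernsteinGauge y :=
  le_iSup (fun κ : {κ // IsBaernsteinFunctional κ} => ∑' i, (κ.1 i : ℝ≥0∞) * y i) ⟨κ, hκ⟩

theorem baernsteinGauge_mono {y z : ℕ → ℝ≥0∞} (h : ∀ i, y i ≤ z i) :
    baernsteinGauge y ≤ baernsteinGauge z :=
  iSup_mono fun _ => ENNReal.tsum_le_tsum fun i => by gcongr; exact h i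

theorem baernsteinGauge_add_le (y z : ℕ → ℝ≥0∞) :
    baernsteinGauge (fun i => y i + z i) ≤ baernsteinGauge y + baernsteinGauge z := by
  refine iSup_le fun κ => ?_
  simp only [mul_add]
  rw [ENNReal.tsum_add]
  exact add_le_add (le_baernsteinGauge κ.2 y) (le_baernsteinGauge κ.2 z)

theorem baernsteinGauge_const_mul (c : ℝ≥0∞) (y : ℕ → ℝ≥0∞) :
    baernsteinGauge (fun i => c * y i) = c * baernsteinGauge y := by
  rw [baernsteinGauge, baernsteinGauge, ENNReal.mul_iSup]
  refine iSup_congr fun κ => ?_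
  rw [← ENNReal.tsum_mul_left]
  exact tsum_congr fun i => by ring

theorem tsum_indicator_mul (F : Finset ℕ) (y : ℕ → ℝ≥0∞) :
    ∑' i, (((if i ∈ F then 1 else 0 : ℝ≥0) : ℝ≥0) : ℝ≥0∞) * y i = ∑ i ∈ F, y i := by
  rw [tsum_eq_sum (s := F) fun i hi => by simp [hi]]
  exact Finset.sum_congr rfl fun i hi => by simp [hi]

theorem sum_le_baernsteinGauge {F : Finset ℕ} (hF : ∀ i ∈ F, F.card ≤ i + 1) (y : ℕ → ℝ≥0∞) :
    ∑ i ∈ F, y i ≤ baernsteinGauge y := by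
  rw [← tsum_indicator_mul]
  exact le_baernsteinGauge (.indicator F hF) y

theorem apply_le_baernsteinGauge (y : ℕ → ℝ≥0∞) (i : ℕ) : y i ≤ baernsteinGauge y := by
  simpa using sum_le_baernsteinGauge (F := {i}) (by simp) y

/-- Lower semicontinuity of the gauge under coordinatewise convergence. -/
theorem baernsteinGauge_le_of_tendsto {y : ℕ → ℝ≥0∞} {z : ℕ → ℕ → ℝ≥0∞} {C : ℝ≥0∞}
    (hz : ∀ i, Tendsto (fun m => z m i) atTop (𝓝 (y i)))
    (hC : ∀ᶠ m in atTop, baernsteinGauge (z m) ≤ C) : baernsteinGauge y ≤ C := by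
  refine iSup_le fun κ => ?_
  rw [ENNReal.tsum_eq_iSup_nat]
  refine iSup_le fun n => ?_
  refine le_of_tendsto (tendsto_finsetSum (Finset.range n) fun i _ =>
    ENNReal.Tendsto.const_mul (hz i) (Or.inr ENNReal.coe_ne_top)) ?_
  filter_upwards [hC] with m hm
  exact (ENNReal.sum_le_tsum _).trans ((le_baernsteinGauge κ.2 _).trans hm)

theorem baernsteinGauge_le_of_head {y : ℕ → ℝ≥0∞} {C : ℝ≥0∞}
    (hC : ∀ n, baernsteinGauge (head n y) ≤ C) : baernsteinGauge y ≤ C := by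
  refine baernsteinGauge_le_of_tendsto (z := fun n => head n y) (fun i => ?_)
    (Eventually.of_forall hC)
  refine tendsto_const_nhds.congr' ?_
  filter_upwards [eventually_gt_atTop i] with n hn
  simp [head, hn]

theorem tsum_join_mul (s : ℕ) (a b : ℝ≥0) (κ₁ κ₂ : ℕ → ℝ≥0) (y : ℕ → ℝ≥0∞) :
    ∑' i, (((if i < s then a * κ₁ i else b * κ₂ i : ℝ≥0)) : ℝ≥0∞) * y i =
      a * ∑' i, (κ₁ i : ℝ≥0∞) * head s y i + b * ∑' i, (κ₂ i : ℝ≥0∞) * tail s y i := by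
  rw [← ENNReal.tsum_mul_left, ← ENNReal.tsum_mul_left, ← ENNReal.tsum_add]
  refine tsum_congr fun i => ?_
  by_cases h : i < s <;> simp [h, head, tail, mul_assoc]

/-- Functionals with values `p` on the head and `q` on the tail are joined with weights `p / r` and
`q / r`, where `r ^ 2 = p ^ 2 + q ^ 2`; the joined functional takes the value `r`. -/
theorem sq_add_sq_le_baernsteinGauge_sq (s : ℕ) (y : ℕ → ℝ≥0∞) :
    baernsteinGauge (head s y) ^ 2 + baernsteinGauge (tail s y) ^ 2 ≤ baernsteinGauge y ^ 2 := by
  rcases eq_or_ne (baernsteinGauge y) ⊤ with htop | htop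
  · simp [htop]
  have hmap : ∀ z : ℕ → ℝ≥0∞, baernsteinGauge z ^ 2 =
      ⨆ κ : {κ // IsBaernsteinFunctional κ}, (∑' i, (κ.1 i : ℝ≥0∞) * z i) ^ 2 := fun z => by
    have : Monotone fun t : ℝ≥0∞ => t ^ 2 := fun a b h => pow_le_pow_left' h 2
    exact this.map_iSup_of_continuousAt (ENNReal.continuous_pow 2).continuousAt (by simp)
  have : Nonempty {κ // IsBaernsteinFunctional κ} := ⟨_, .indicator ∅ (by simp)⟩
  rw [hmap (head s y), hmap (tail s y)]
  refine ENNReal.iSup_add_iSup_le fun κ₁ κ₂ => ?_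
  have h1 : ∑' i, (κ₁.1 i : ℝ≥0∞) * head s y i ≤ baernsteinGauge y :=
    (le_baernsteinGauge κ₁.2 _).trans (baernsteinGauge_mono fun i => by
      rw [head]; split_ifs <;> simp)
  have h2 : ∑' i, (κ₂.1 i : ℝ≥0∞) * tail s y i ≤ baernsteinGauge y :=
    (le_baernsteinGauge κ₂.2 _).trans (baernsteinGauge_mono fun i => by
      rw [tail]; split_ifs <;> simp)
  obtain ⟨p, hp⟩ : ∃ p : ℝ≥0, (p : ℝ≥0∞) = ∑' i, (κ₁.1 i : ℝ≥0∞) * head s y i :=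
    ⟨_, ENNReal.coe_toNNReal (ne_top_of_le_ne_top htop h1)⟩
  obtain ⟨q, hq⟩ : ∃ q : ℝ≥0, (q : ℝ≥0∞) = ∑' i, (κ₂.1 i : ℝ≥0∞) * tail s y i :=
    ⟨_, ENNReal.coe_toNNReal (ne_top_of_le_ne_top htop h2)⟩
  rw [← hp, ← hq]
  set r := NNReal.sqrt (p ^ 2 + q ^ 2) with hr
  have hr2 : r ^ 2 = p ^ 2 + q ^ 2 := NNReal.sq_sqrt _
  have hle : (r : ℝ≥0∞) ≤ baernsteinGauge y := by
    rcases eq_or_ne r 0 with h0 | h0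
    · simp [h0]
    have hab : (p / r) ^ 2 + (q / r) ^ 2 ≤ 1 := by
      rw [div_pow, div_pow, ← add_div, ← hr2, div_self (pow_ne_zero _ h0)]
    refine le_trans (le_of_eq ?_) (le_baernsteinGauge (.join s (p / r) (q / r) hab κ₁.2 κ₂.2) y)
    rw [tsum_join_mul, ← hp, ← hq]
    norm_cast
    rw [div_mul_eq_mul_div, div_mul_eq_mul_div, ← add_div, ← sq, ← sq, ← hr2, sq,
      mul_div_assoc, div_self h0, mul_one]
  calc (p : ℝ≥0∞) ^ 2 + (q : ℝ≥0∞) ^ 2 = (r : ℝ≥0∞) ^ 2 := by norm_cast; exact hr2.symm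
    _ ≤ _ := by gcongr

theorem sq_add_le_of_sq_add_sq_le_one {a b : ℝ≥0} (hab : a ^ 2 + b ^ 2 ≤ 1) (p q : ℝ≥0∞) :
    (a * p + b * q) ^ 2 ≤ p ^ 2 + q ^ 2 := by
  rcases eq_or_ne p ⊤ with rfl | hp
  · simp
  rcases eq_or_ne q ⊤ with rfl | hq
  · simp
  lift p to ℝ≥0 using hp
  lift q to ℝ≥0 using hq
  norm_cast
  rw [← NNReal.coe_le_coe] at hab ⊢
  push_cast at hab ⊢
  nlinarith [sq_nonneg ((a : ℝ) * q - b * p), sq_nonneg (p : ℝ), sq_nonneg (q : ℝ)]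

theorem IsBaernsteinFunctional.le_one {κ : ℕ → ℝ≥0} (hκ : IsBaernsteinFunctional κ) (i : ℕ) :
    κ i ≤ 1 := by
  induction hκ with
  | indicator F hF => dsimp only; split_ifs <;> simp
  | join s a b hab h₁ h₂ ih₁ ih₂ =>
    have ha : a ≤ 1 := (sq_le_one_iff₀ zero_le).1 ((le_add_of_nonneg_right zero_le).trans hab)
    have hb : b ≤ 1 := (sq_le_one_iff₀ zero_le).1 ((le_add_of_nonneg_left zero_le).trans hab)
    dsimp only
    split_ifs
    · exact mul_le_one₀ ha zero_le ih₁
    · exact mul_le_one₀ hb zero_le ih₂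

theorem head_head_of_le {s L : ℕ} (h : s ≤ L) (y : ℕ → ℝ≥0∞) : head s (head L y) = head s y := by
  funext i; simp only [head]; split_ifs <;> first | rfl | omega

theorem head_head_of_ge {s L : ℕ} (h : L ≤ s) (y : ℕ → ℝ≥0∞) : head L (head s y) = head L y :=
  head_head_of_le h y

theorem tail_tail_of_le {s L : ℕ} (h : s ≤ L) (y : ℕ → ℝ≥0∞) : tail L (tail s y) = tail L y := by
  funext i; simp only [tail]; split_ifs <;> first | rfl | omega

theorem tail_tail_of_ge {s L : ℕ} (h : L ≤ s) (y : ℕ → ℝ≥0∞) : tail s (tail L y) = tail s y :=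
  tail_tail_of_le h y

theorem head_tail_comm (s L : ℕ) (y : ℕ → ℝ≥0∞) : head s (tail L y) = tail L (head s y) := by
  funext i; simp only [head, tail]; split_ifs <;> rfl

theorem head_le (s : ℕ) (y : ℕ → ℝ≥0∞) (i : ℕ) : head s y i ≤ y i := by
  rw [head]; split_ifs <;> simp

theorem head_add_tail (s : ℕ) (y : ℕ → ℝ≥0∞) (i : ℕ) : head s y i + tail s y i = y i := by
  rw [head, tail]; split_ifs <;> simp

/-- A norming functional splits at `L` in an `ℓ²`-fashion, up to the sum over at most `L`
coordinates beyond `L`. -/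
theorem IsBaernsteinFunctional.exists_split {κ : ℕ → ℝ≥0} (hκ : IsBaernsteinFunctional κ) (L : ℕ) :
    ∃ F : Finset ℕ, F.card ≤ L ∧ ∀ y : ℕ → ℝ≥0∞, ∃ t : ℝ≥0∞,
      t ^ 2 ≤ baernsteinGauge (head L y) ^ 2 + baernsteinGauge (tail L y) ^ 2 ∧
      ∑' i, (κ i : ℝ≥0∞) * y i ≤ t + ∑ i ∈ F, tail L y i := by
  induction hκ with
  | indicator F hF =>
    -- A Schreier set meeting `[0, L)` has at most `L` elements and serves as its own exceptional
    -- set; one that misses `[0, L)` only sees the tail.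
    by_cases h : ∃ i ∈ F, i < L
    · obtain ⟨i, hi, hiL⟩ := h
      refine ⟨F, (hF i hi).trans hiL, fun y => ⟨∑ i ∈ F, head L y i, ?_, ?_⟩⟩
      · refine le_add_right ?_
        gcongr
        exact sum_le_baernsteinGauge hF _
      · rw [tsum_indicator_mul, ← Finset.sum_add_distrib]
        simp only [head_add_tail, le_refl]
    · push Not at h
      refine ⟨∅, by simp, fun y => ⟨∑ i ∈ F, tail L y i, ?_, ?_⟩⟩
      · refine le_add_left ?_
        gcongr
        exact sum_le_baernsteinGauge hF _
      · rw [tsum_indicator_mul, Finset.sum_empty, add_zero]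
        refine Finset.sum_le_sum fun i hi => ?_
        simp [tail, not_lt.2 (h i hi)]
  | join s a b hab h₁ h₂ ih₁ ih₂ =>
    rename_i κ₁ κ₂
    have ha : (a : ℝ≥0∞) ≤ 1 := by
      have h : a ^ 2 ≤ 1 := (le_add_of_nonneg_right (zero_le (a := b ^ 2))).trans hab
      exact_mod_cast (sq_le_one_iff₀ (zero_le (a := a))).1 h
    have hb : (b : ℝ≥0∞) ≤ 1 := by
      have h : b ^ 2 ≤ 1 := (le_add_of_nonneg_left (zero_le (a := a ^ 2))).trans hab
      exact_mod_cast (sq_le_one_iff₀ (zero_le (a := b))).1 h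
    -- The cut `L` falls into only one of the two pieces. Only that piece is split further, so its
    -- exceptional set is reused and its size does not grow.
    rcases le_total s L with hsL | hLs
    · obtain ⟨F, hFL, hF⟩ := ih₂
      refine ⟨F, hFL, fun y => ?_⟩
      obtain ⟨t, ht, hκt⟩ := hF (tail s y)
      rw [tail_tail_of_le hsL] at ht hκt
      set p := ∑' i, (κ₁ i : ℝ≥0∞) * head s y i with hp
      have hp1 : p ≤ baernsteinGauge (head s (head L y)) := by
        rw [head_head_of_le hsL]; exact le_baernsteinGauge h₁ _
      refine ⟨a * p + b * t, (sq_add_le_of_sq_add_sq_le_one hab p t).trans ?_, ?_⟩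
      · have h3 := sq_add_sq_le_baernsteinGauge_sq s (head L y)
        rw [← head_tail_comm] at h3
        calc p ^ 2 + t ^ 2 ≤ baernsteinGauge (head s (head L y)) ^ 2 +
              (baernsteinGauge (head L (tail s y)) ^ 2 + baernsteinGauge (tail L y) ^ 2) := by
              gcongr
          _ ≤ _ := by rw [← add_assoc]; gcongr
      · rw [tsum_join_mul]
        calc _ ≤ a * p + b * (t + ∑ i ∈ F, tail L y i) := by gcongr
          _ = a * p + b * t + b * ∑ i ∈ F, tail L y i := by ring
          _ ≤ a * p + b * t + 1 * ∑ i ∈ F, tail L y i := by gcongr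
          _ = _ := by rw [one_mul]
    · obtain ⟨F, hFL, hF⟩ := ih₁
      refine ⟨F, hFL, fun y => ?_⟩
      obtain ⟨t, ht, hκt⟩ := hF (head s y)
      rw [head_head_of_ge hLs] at ht
      set q := ∑' i, (κ₂ i : ℝ≥0∞) * tail s y i with hq
      have hq1 : q ≤ baernsteinGauge (tail s (tail L y)) := by
        rw [tail_tail_of_ge hLs]; exact le_baernsteinGauge h₂ _
      refine ⟨a * t + b * q, (sq_add_le_of_sq_add_sq_le_one hab t q).trans ?_, ?_⟩
      · have h3 := sq_add_sq_le_baernsteinGauge_sq s (tail L y)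
        rw [head_tail_comm] at h3
        calc t ^ 2 + q ^ 2 ≤ baernsteinGauge (head L y) ^ 2 +
              baernsteinGauge (tail L (head s y)) ^ 2 +
              baernsteinGauge (tail s (tail L y)) ^ 2 := by gcongr
          _ ≤ _ := by rw [add_assoc]; gcongr
      · rw [tsum_join_mul]
        have h4 : ∑ i ∈ F, tail L (head s y) i ≤ ∑ i ∈ F, tail L y i :=
          Finset.sum_le_sum fun i _ => by rw [← head_tail_comm]; exact head_le _ _ _
        calc _ ≤ a * (t + ∑ i ∈ F, tail L y i) + b * q := by gcongr; exact hκt.trans (by gcongr)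
          _ = a * t + b * q + a * ∑ i ∈ F, tail L y i := by ring
          _ ≤ a * t + b * q + 1 * ∑ i ∈ F, tail L y i := by gcongr
          _ = _ := by rw [one_mul]

/-- A converse to `sq_add_sq_le_baernsteinGauge_sq` for flat tails: the exceptional set has at most
`L` elements, each contributing at most `δ`. -/
theorem baernsteinGauge_le_add {y : ℕ → ℝ≥0∞} {L : ℕ} {R δ : ℝ≥0∞}
    (hR : baernsteinGauge (head L y) ^ 2 + baernsteinGauge (tail L y) ^ 2 ≤ R ^ 2)
    (hδ : ∀ i, tail L y i ≤ δ) : baernsteinGauge y ≤ R + L * δ := by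
  refine iSup_le fun κ => ?_
  obtain ⟨F, hFL, hF⟩ := κ.2.exists_split L
  obtain ⟨t, ht, hκt⟩ := hF y
  have h1 : t ≤ R := (ENNReal.pow_le_pow_left_iff two_ne_zero).1 (ht.trans hR)
  have h2 : ∑ i ∈ F, tail L y i ≤ L * δ := by
    refine (Finset.sum_le_card_nsmul _ _ _ fun i _ => hδ i).trans ?_
    rw [nsmul_eq_mul]
    gcongr
  exact hκt.trans (add_le_add h1 h2)

end BaernsteinGauge

/-! ### Baernstein's space as a Banach space with a basis -/

section BaernsteinSpace

variable {𝕜 : Type*} [RCLike 𝕜]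

variable (𝕜) in
/-- The sequences with finite Baernstein norm. -/
def baernsteinSubmodule : Submodule 𝕜 (ℕ → 𝕜) where
  carrier := {x | baernsteinGauge (fun i => ‖x i‖ₑ) ≠ ⊤}
  zero_mem' := by
    have := baernsteinGauge_const_mul 0 (fun _ => 0)
    simp only [zero_mul] at this
    simp [this]
  add_mem' {x y} hx hy := by
    refine ne_top_of_le_ne_top (ENNReal.add_ne_top.2 ⟨hx, hy⟩)
      (le_trans (baernsteinGauge_mono fun i => ?_) (baernsteinGauge_add_le _ _))
    exact enorm_add_le _ _
  smul_mem' c x hx := by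
    have : (fun i => ‖(c • x) i‖ₑ) = fun i => ‖c‖ₑ * ‖x i‖ₑ := by
      funext i; simp
    rw [Set.mem_ofPred_eq, this, baernsteinGauge_const_mul]
    exact ENNReal.mul_ne_top enorm_ne_top hx

variable (𝕜) in
/-- Baernstein's space. -/
def BaernsteinSpace : Type _ := baernsteinSubmodule 𝕜

namespace BaernsteinSpace

noncomputable instance : AddCommGroup (BaernsteinSpace 𝕜) :=
  inferInstanceAs (AddCommGroup (baernsteinSubmodule 𝕜))

noncomputable instance : Module 𝕜 (BaernsteinSpace 𝕜) :=
  inferInstanceAs (Module 𝕜 (baernsteinSubmodule 𝕜))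

/-- The sequence of moduli of the coordinates. -/
noncomputable def modulus (x : BaernsteinSpace 𝕜) (i : ℕ) : ℝ≥0∞ := ‖x.1 i‖ₑ

theorem gauge_modulus_ne_top (x : BaernsteinSpace 𝕜) : baernsteinGauge x.modulus ≠ ⊤ := x.2

noncomputable instance : Norm (BaernsteinSpace 𝕜) := ⟨fun x => (baernsteinGauge x.modulus).toReal⟩

theorem norm_def (x : BaernsteinSpace 𝕜) : ‖x‖ = (baernsteinGauge x.modulus).toReal := rfl

theorem add_apply (x y : BaernsteinSpace 𝕜) (i : ℕ) : (x + y).1 i = x.1 i + y.1 i := rfl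

theorem sub_apply (x y : BaernsteinSpace 𝕜) (i : ℕ) : (x - y).1 i = x.1 i - y.1 i := rfl

theorem smul_apply (c : 𝕜) (x : BaernsteinSpace 𝕜) (i : ℕ) : (c • x).1 i = c * x.1 i := rfl

theorem zero_apply (i : ℕ) : (0 : BaernsteinSpace 𝕜).1 i = 0 := rfl

theorem ext_coord {x y : BaernsteinSpace 𝕜} (h : ∀ i, x.1 i = y.1 i) : x = y :=
  Subtype.ext (funext h)

theorem modulus_smul (c : 𝕜) (x : BaernsteinSpace 𝕜) :
    (c • x).modulus = fun i => ‖c‖ₑ * x.modulus i := by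
  funext i; rw [modulus, smul_apply, enorm_mul]; rfl

theorem norm_coord_le (x : BaernsteinSpace 𝕜) (i : ℕ) : ‖x.1 i‖ ≤ ‖x‖ := by
  have := ENNReal.toReal_mono x.gauge_modulus_ne_top (apply_le_baernsteinGauge x.modulus i)
  rwa [modulus, toReal_enorm] at this

theorem normedSpaceCore : NormedSpace.Core 𝕜 (BaernsteinSpace 𝕜) where
  norm_nonneg _ := ENNReal.toReal_nonneg
  norm_smul c x := by
    rw [norm_def, modulus_smul, baernsteinGauge_const_mul, ENNReal.toReal_mul, toReal_enorm]
    rfl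
  norm_triangle x y := by
    have h := (baernsteinGauge_mono (y := (x + y).modulus)
      (z := fun i => x.modulus i + y.modulus i) fun i => enorm_add_le _ _).trans
      (baernsteinGauge_add_le _ _)
    have h2 := ENNReal.toReal_mono
      (ENNReal.add_ne_top.2 ⟨x.gauge_modulus_ne_top, y.gauge_modulus_ne_top⟩) h
    rwa [ENNReal.toReal_add x.gauge_modulus_ne_top y.gauge_modulus_ne_top] at h2
  norm_eq_zero_iff x := by
    refine ⟨fun h => ext_coord fun i => ?_, ?_⟩
    · have := norm_coord_le x i
      rw [h] at this
      exact norm_le_zero_iff.1 this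
    · rintro rfl
      have h : (0 : BaernsteinSpace 𝕜).modulus = fun _ => 0 * 0 := by
        funext i; simp [modulus, zero_apply]
      rw [norm_def, h, baernsteinGauge_const_mul]
      simp

noncomputable instance : NormedAddCommGroup (BaernsteinSpace 𝕜) :=
  NormedAddCommGroup.ofCore normedSpaceCore

noncomputable instance : NormedSpace 𝕜 (BaernsteinSpace 𝕜) :=
  NormedSpace.ofCore normedSpaceCore

theorem ofReal_norm_eq (x : BaernsteinSpace 𝕜) :
    ENNReal.ofReal ‖x‖ = baernsteinGauge x.modulus :=
  ENNReal.ofReal_toReal x.gauge_modulus_ne_top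

theorem norm_le_of_gauge_le {x : BaernsteinSpace 𝕜} {C : ℝ} (hC : 0 ≤ C)
    (h : baernsteinGauge x.modulus ≤ ENNReal.ofReal C) : ‖x‖ ≤ C := by
  rw [← ofReal_norm_eq] at h
  exact (ENNReal.ofReal_le_ofReal_iff hC).1 h

theorem modulus_sub (x y : BaernsteinSpace 𝕜) :
    (x - y).modulus = fun i => ‖x.1 i - y.1 i‖ₑ := rfl

/-- A Cauchy sequence converges coordinatewise, and lower semicontinuity of the gauge turns this
into norm convergence. -/
instance : CompleteSpace (BaernsteinSpace 𝕜) := by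
  refine Metric.complete_of_cauchySeq_tendsto fun v hv => ?_
  have hcoord : ∀ i, ∃ b : 𝕜, Tendsto (fun n => (v n).1 i) atTop (𝓝 b) := fun i => by
    refine cauchySeq_tendsto_of_complete (Metric.cauchySeq_iff.2 fun ε hε => ?_)
    obtain ⟨N, hN⟩ := Metric.cauchySeq_iff.1 hv ε hε
    refine ⟨N, fun m hm n hn => lt_of_le_of_lt ?_ (hN m hm n hn)⟩
    rw [dist_eq_norm, dist_eq_norm, ← sub_apply]
    exact norm_coord_le _ _
  choose b hb using hcoord
  have key : ∀ ε > 0, ∃ N, ∀ n ≥ N,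
      baernsteinGauge (fun i => ‖(v n).1 i - b i‖ₑ) ≤ ENNReal.ofReal ε := by
    intro ε hε
    obtain ⟨N, hN⟩ := Metric.cauchySeq_iff.1 hv ε hε
    refine ⟨N, fun n hn => baernsteinGauge_le_of_tendsto (z := fun m => (v n - v m).modulus)
      (fun i => ?_) ?_⟩
    · simp only [modulus_sub]
      exact ((hb i).const_sub ((v n).1 i)).enorm
    · filter_upwards [eventually_ge_atTop N] with m hm
      rw [← ofReal_norm_eq, ← dist_eq_norm]
      exact ENNReal.ofReal_le_ofReal (hN n hn m hm).le
  have hmem : baernsteinGauge (fun i => ‖b i‖ₑ) ≠ ⊤ := by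
    obtain ⟨N, hN⟩ := key 1 one_pos
    refine ne_top_of_le_ne_top (ENNReal.add_ne_top.2 ⟨(v N).gauge_modulus_ne_top,
      ne_top_of_le_ne_top ENNReal.ofReal_ne_top (hN N le_rfl)⟩)
      (le_trans (baernsteinGauge_mono fun i => ?_) (baernsteinGauge_add_le _ _))
    have h1 : ‖b i‖ₑ = ‖(v N).1 i - ((v N).1 i - b i)‖ₑ := by rw [sub_sub_cancel]
    rw [h1]
    exact enorm_sub_le
  let w : BaernsteinSpace 𝕜 := ⟨b, hmem⟩
  refine ⟨w, Metric.tendsto_atTop.2 fun ε hε => ?_⟩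
  obtain ⟨N, hN⟩ := key (ε / 2) (half_pos hε)
  refine ⟨N, fun n hn => ?_⟩
  rw [dist_eq_norm]
  have h1 := hN n hn
  have h2 : baernsteinGauge (v n - w).modulus ≤ ENNReal.ofReal (ε / 2) := by
    rw [modulus_sub]; exact h1
  exact (norm_le_of_gauge_le (half_pos hε).le h2).trans_lt (half_lt_self hε)

variable (𝕜) in
/-- The coordinate functionals. -/
noncomputable def coord (i : ℕ) : StrongDual 𝕜 (BaernsteinSpace 𝕜) :=
  LinearMap.mkContinuous
    { toFun := fun x => x.1 i
      map_add' := fun _ _ => rfl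
      map_smul' := fun _ _ => rfl } 1 fun x => by rw [one_mul]; exact norm_coord_le x i

@[simp] theorem coord_apply (i : ℕ) (x : BaernsteinSpace 𝕜) : coord 𝕜 i x = x.1 i := rfl

theorem gauge_ne_top_of_head_eq {y : ℕ → ℝ≥0∞} {n : ℕ} (hy : ∀ i, y i ≠ ⊤)
    (hn : ∀ i, n ≤ i → y i = 0) : baernsteinGauge y ≠ ⊤ := by
  refine ne_top_of_le_ne_top (b := ∑ i ∈ Finset.range n, y i)
    (ENNReal.sum_ne_top.2 fun i _ => hy i) (iSup_le fun κ => ?_)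
  rw [tsum_eq_sum (s := Finset.range n) fun i hi => by
    rw [hn i (by simpa using hi), mul_zero]]
  refine Finset.sum_le_sum fun i _ => ?_
  calc (κ.1 i : ℝ≥0∞) * y i ≤ 1 * y i := by gcongr; exact_mod_cast κ.2.le_one i
    _ = y i := one_mul _

variable (𝕜) in
/-- The unit vectors. -/
noncomputable def unit (n : ℕ) : BaernsteinSpace 𝕜 :=
  ⟨Pi.single n 1, gauge_ne_top_of_head_eq (n := n + 1) (fun _ => enorm_ne_top) fun i hi => by
    rw [Pi.single_eq_of_ne (by omega), enorm_zero]⟩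

theorem unit_apply (n i : ℕ) : (unit 𝕜 n).1 i = if i = n then 1 else 0 := by
  exact Pi.single_apply n 1 i

variable (𝕜) in
/-- The canonical projection onto the span of the first `n` unit vectors. -/
noncomputable def proj (n : ℕ) : BaernsteinSpace 𝕜 →L[𝕜] BaernsteinSpace 𝕜 :=
  ∑ i ∈ Finset.range n, (coord 𝕜 i).smulRight (unit 𝕜 i)

theorem proj_eq_sum (n : ℕ) (x : BaernsteinSpace 𝕜) :
    proj 𝕜 n x = ∑ i ∈ Finset.range n, x.1 i • unit 𝕜 i := by
  simp [proj]

theorem sum_apply (s : Finset ℕ) (f : ℕ → BaernsteinSpace 𝕜) (i : ℕ) :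
    (∑ n ∈ s, f n).1 i = ∑ n ∈ s, (f n).1 i := by
  exact map_sum (coord 𝕜 i) f s

theorem sum_smul_unit_apply (n : ℕ) (b : ℕ → 𝕜) (i : ℕ) :
    (∑ j ∈ Finset.range n, b j • unit 𝕜 j).1 i = if i < n then b i else 0 := by
  rw [sum_apply]
  simp only [smul_apply, unit_apply, mul_ite, mul_one, mul_zero]
  simp

theorem proj_apply (n : ℕ) (x : BaernsteinSpace 𝕜) (i : ℕ) :
    (proj 𝕜 n x).1 i = if i < n then x.1 i else 0 := by
  rw [proj_eq_sum, sum_smul_unit_apply]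

theorem modulus_proj (n : ℕ) (x : BaernsteinSpace 𝕜) :
    (proj 𝕜 n x).modulus = head n x.modulus := by
  funext i
  rw [modulus, proj_apply, head]
  split_ifs <;> simp [modulus]

theorem modulus_sub_proj (n : ℕ) (x : BaernsteinSpace 𝕜) :
    (x - proj 𝕜 n x).modulus = tail n x.modulus := by
  funext i
  rw [modulus, sub_apply, proj_apply, tail]
  split_ifs <;> simp [modulus]

theorem norm_proj_sq_add_le (n : ℕ) (x : BaernsteinSpace 𝕜) :
    ‖proj 𝕜 n x‖ ^ 2 + ‖x - proj 𝕜 n x‖ ^ 2 ≤ ‖x‖ ^ 2 := by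
  have h := sq_add_sq_le_baernsteinGauge_sq n x.modulus
  rw [← modulus_proj, ← modulus_sub_proj, ← ofReal_norm_eq, ← ofReal_norm_eq, ← ofReal_norm_eq,
    ← ENNReal.ofReal_pow (norm_nonneg _), ← ENNReal.ofReal_pow (norm_nonneg _),
    ← ENNReal.ofReal_pow (norm_nonneg _), ← ENNReal.ofReal_add (by positivity) (by positivity)] at h
  exact (ENNReal.ofReal_le_ofReal_iff (by positivity)).1 h

theorem norm_proj_le (n : ℕ) (x : BaernsteinSpace 𝕜) : ‖proj 𝕜 n x‖ ≤ ‖x‖ := by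
  have := norm_proj_sq_add_le n x
  exact le_of_sq_le_sq (by nlinarith [sq_nonneg ‖x - proj 𝕜 n x‖]) (norm_nonneg _)

theorem norm_sub_proj_le (n : ℕ) (x : BaernsteinSpace 𝕜) : ‖x - proj 𝕜 n x‖ ≤ ‖x‖ := by
  have := norm_proj_sq_add_le n x
  exact le_of_sq_le_sq (by nlinarith [sq_nonneg ‖proj 𝕜 n x‖]) (norm_nonneg _)

theorem proj_proj_of_le {m n : ℕ} (h : m ≤ n) (x : BaernsteinSpace 𝕜) :
    proj 𝕜 m (proj 𝕜 n x) = proj 𝕜 m x :=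
  ext_coord fun i => by
    rw [proj_apply, proj_apply, proj_apply]; split_ifs <;> first | rfl | omega

theorem monotone_norm_proj (x : BaernsteinSpace 𝕜) : Monotone fun n => ‖proj 𝕜 n x‖ :=
  fun m n h => by
    dsimp only
    rw [← proj_proj_of_le h]
    exact norm_proj_le _ _

/-- The unit vectors form a basis. -/
theorem tendsto_proj (x : BaernsteinSpace 𝕜) : Tendsto (fun n => proj 𝕜 n x) atTop (𝓝 x) := by
  have hbdd : BddAbove (Set.range fun n => ‖proj 𝕜 n x‖) :=
    ⟨‖x‖, by rintro _ ⟨n, rfl⟩; exact norm_proj_le n x⟩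
  have h1 := tendsto_atTop_ciSup (monotone_norm_proj x) hbdd
  have h2 : (⨆ n, ‖proj 𝕜 n x‖) = ‖x‖ := by
    refine le_antisymm (ciSup_le fun n => norm_proj_le n x) ?_
    refine norm_le_of_gauge_le ((norm_nonneg _).trans (le_ciSup hbdd 0))
      (baernsteinGauge_le_of_head fun n => ?_)
    rw [← modulus_proj, ← ofReal_norm_eq]
    exact ENNReal.ofReal_le_ofReal (le_ciSup hbdd n)
  rw [h2] at h1
  -- The norms of the projections increase to `‖x‖`, and the lower `ℓ²`-estimate bounds the square
  -- of the remainder by the difference of squares.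
  have h3 : Tendsto (fun n => √(‖x‖ ^ 2 - ‖proj 𝕜 n x‖ ^ 2)) atTop (𝓝 0) := by
    have := (((h1.pow 2).const_sub (‖x‖ ^ 2))).sqrt
    simpa using this
  rw [tendsto_iff_norm_sub_tendsto_zero]
  refine squeeze_zero (fun _ => norm_nonneg _) (fun n => ?_) h3
  rw [norm_sub_rev]
  refine Real.le_sqrt_of_sq_le ?_
  linarith [norm_proj_sq_add_le n x]

theorem norm_sum_le {F : Finset ℕ} (hF : ∀ i ∈ F, F.card ≤ i + 1) (x : BaernsteinSpace 𝕜) :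
    ∑ i ∈ F, ‖x.1 i‖ ≤ ‖x‖ := by
  have h := ENNReal.toReal_mono x.gauge_modulus_ne_top (sum_le_baernsteinGauge hF x.modulus)
  simp only [modulus] at h
  rw [ENNReal.toReal_sum fun i _ => enorm_ne_top] at h
  simp only [toReal_enorm] at h
  exact h

/-- The upper estimate: adding a vector with small coordinates and support beyond `n`. -/
theorem norm_add_le_of_support {n : ℕ} {w v : BaernsteinSpace 𝕜} {R δ : ℝ} (hR : 0 ≤ R)
    (hw : ∀ i, n ≤ i → w.1 i = 0) (hv : ∀ i < n, v.1 i = 0) (hδ : ∀ i, ‖v.1 i‖ ≤ δ)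
    (h : ‖w‖ ^ 2 + ‖v‖ ^ 2 ≤ R ^ 2) : ‖w + v‖ ≤ R + n * δ := by
  have hδ0 : 0 ≤ δ := (norm_nonneg _).trans (hδ 0)
  have hhead : head n (w + v).modulus = w.modulus := by
    funext i
    simp only [head, modulus, add_apply]
    split_ifs with hi
    · rw [hv i hi, add_zero]
    · rw [hw i (not_lt.1 hi), enorm_zero]
  have htail : tail n (w + v).modulus = v.modulus := by
    funext i
    simp only [tail, modulus, add_apply]
    split_ifs with hi
    · rw [hv i hi, enorm_zero]
    · rw [hw i (not_lt.1 hi), zero_add]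
  refine norm_le_of_gauge_le (by positivity) ?_
  have := baernsteinGauge_le_add (y := (w + v).modulus) (L := n) (R := ENNReal.ofReal R)
    (δ := ENNReal.ofReal δ) (by
      rw [hhead, htail, ← ofReal_norm_eq, ← ofReal_norm_eq, ← ENNReal.ofReal_pow (norm_nonneg _),
        ← ENNReal.ofReal_pow (norm_nonneg _), ← ENNReal.ofReal_pow hR,
        ← ENNReal.ofReal_add (by positivity) (by positivity)]
      exact ENNReal.ofReal_le_ofReal h) (fun i => by
      rw [htail, modulus, ← ofReal_norm]
      exact ENNReal.ofReal_le_ofReal (hδ i))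
  rw [ENNReal.ofReal_add hR (by positivity), ENNReal.ofReal_mul (by positivity)]
  simpa using this

end BaernsteinSpace

end BaernsteinSpace

/-! ### Shrinking basis, reflexivity and separability -/

namespace BaernsteinSpace

variable {𝕜 : Type*} [RCLike 𝕜]

theorem proj_eq_zero_of_support {n : ℕ} {x : BaernsteinSpace 𝕜} (h : ∀ i < n, x.1 i = 0) :
    proj 𝕜 n x = 0 :=
  ext_coord fun i => by
    rw [proj_apply, zero_apply]; split_ifs with hi
    · exact h i hi
    · rfl

section Shrinking

variable {g : StrongDual 𝕜 (BaernsteinSpace 𝕜)} {ε : ℝ}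

/-- If `g` stays large on the tails then it is large on blocks supported arbitrarily far out. -/
theorem exists_block (hg : ∀ n, ∃ x : BaernsteinSpace 𝕜, ‖x‖ ≤ 1 ∧ ε < ‖g (x - proj 𝕜 n x)‖)
    (n : ℕ) : ∃ v : BaernsteinSpace 𝕜, ∃ m, ‖v‖ ≤ 1 ∧ (∀ i < n, v.1 i = 0) ∧
      (∀ i, m ≤ i → v.1 i = 0) ∧ ε ≤ RCLike.re (g v) := by
  obtain ⟨x, hx, hgx⟩ := hg n
  set z := x - proj 𝕜 n x with hz
  -- The unimodular `c` rotates `g z` onto the nonnegative reals, so that values of `g` on several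
  -- blocks add up without cancellation.
  obtain ⟨c, hc, hcg⟩ := RCLike.exists_norm_eq_mul_self (g z)
  have h1 : Tendsto (fun m => RCLike.re (g (proj 𝕜 m (c • z)))) atTop (𝓝 (RCLike.re (g (c • z)))) :=
    (RCLike.continuous_re.tendsto _).comp ((g.continuous.tendsto _).comp (tendsto_proj (c • z)))
  have h2 : RCLike.re (g (c • z)) = ‖g z‖ := by
    rw [map_smul, smul_eq_mul, ← hcg, RCLike.ofReal_re]
  rw [h2] at h1
  obtain ⟨m, hm⟩ := (h1.eventually_const_lt hgx).exists
  refine ⟨proj 𝕜 m (c • z), m, ?_, fun i hi => ?_, fun i hi => ?_, hm.le⟩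
  · refine (norm_proj_le _ _).trans ?_
    rw [norm_smul, hc, one_mul]
    exact (norm_sub_proj_le _ _).trans hx
  · rw [proj_apply, smul_apply, hz, sub_apply, proj_apply, if_pos hi, sub_self, mul_zero, ite_self]
  · rw [proj_apply, if_neg (not_lt.2 hi)]

/-- Averaging makes the coordinates of the blocks small. -/
theorem exists_flat_block (hg : ∀ n, ∃ x : BaernsteinSpace 𝕜, ‖x‖ ≤ 1 ∧ ε < ‖g (x - proj 𝕜 n x)‖)
    (r n : ℕ) : ∃ v : BaernsteinSpace 𝕜, ∃ m, ‖v‖ ≤ 1 ∧ (∀ i < n, v.1 i = 0) ∧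
      (∀ i, m ≤ i → v.1 i = 0) ∧ ε ≤ RCLike.re (g v) ∧ ∀ i, ‖v.1 i‖ ≤ (1 / 2) ^ r := by
  induction r generalizing n with
  | zero =>
    obtain ⟨v, m, h1, h2, h3, h4⟩ := exists_block hg n
    exact ⟨v, m, h1, h2, h3, h4, fun i => by simpa using (norm_coord_le v i).trans h1⟩
  | succ r ih =>
    obtain ⟨v, m, h1, h2, h3, h4, h5⟩ := ih n
    obtain ⟨v', m', h1', h2', h3', h4', h5'⟩ := ih (max m n)
    have e2 : ‖(((1 / 2 : ℝ)) : 𝕜)‖ = 1 / 2 := by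
      rw [RCLike.norm_ofReal, abs_of_pos (by norm_num)]
    refine ⟨((1 / 2 : ℝ) : 𝕜) • (v + v'), max m m', ?_, fun i hi => ?_, fun i hi => ?_, ?_,
      fun i => ?_⟩
    · rw [norm_smul, e2]
      linarith [norm_add_le v v']
    · rw [smul_apply, add_apply, h2 i hi, h2' i (hi.trans_le (le_max_right _ _)), add_zero,
        mul_zero]
    · rw [smul_apply, add_apply, h3 i ((le_max_left _ _).trans hi),
        h3' i ((le_max_right _ _).trans hi), add_zero, mul_zero]
    · rw [map_smul, smul_eq_mul, RCLike.re_ofReal_mul, map_add, map_add]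
      linarith
    · rw [smul_apply, add_apply, norm_mul, e2, pow_succ']
      rcases lt_or_ge i (max m n) with hi | hi
      · rw [h2' i hi, add_zero]
        gcongr
        exact h5 i
      · rw [h3 i ((le_max_left _ _).trans hi), zero_add]
        gcongr
        exact h5' i

/-- Successive flat blocks satisfy an upper `ℓ²`-estimate. -/
theorem exists_sum_blocks (hg : ∀ n, ∃ x : BaernsteinSpace 𝕜, ‖x‖ ≤ 1 ∧ ε < ‖g (x - proj 𝕜 n x)‖)
    (k : ℕ) : ∃ w : BaernsteinSpace 𝕜, ∃ m, ‖w‖ ≤ √(2 * k) ∧ (∀ i, m ≤ i → w.1 i = 0) ∧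
      k * ε ≤ RCLike.re (g w) := by
  induction k with
  | zero => exact ⟨0, 0, by simp, fun i _ => rfl, by simp⟩
  | succ k ih =>
    obtain ⟨w, m, h1, h2, h3⟩ := ih
    -- An exact `ℓ²`-estimate would give `√(2 * k + 1)`. The slack up to `√(2 * (k + 1))` absorbs
    -- the error `m * (1 / 2) ^ r` once the new block is flat enough.
    have hη : 0 < √(2 * (k + 1 : ℕ)) - √(2 * k + 1) := by
      rw [sub_pos]
      refine Real.sqrt_lt_sqrt (by positivity) ?_
      push_cast
      linarith
    obtain ⟨r, hr⟩ := exists_pow_lt_of_lt_one (div_pos hη (by positivity : (0 : ℝ) < m + 1))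
      (by norm_num : (1 / 2 : ℝ) < 1)
    obtain ⟨v, m', h1', h2', h3', h4', h5'⟩ := exists_flat_block hg r m
    refine ⟨w + v, max m m', ?_, fun i hi => ?_, ?_⟩
    · have hk : ‖w‖ ^ 2 ≤ 2 * k := (Real.le_sqrt (norm_nonneg _) (by positivity)).1 h1
      have hv : ‖v‖ ^ 2 ≤ 1 := pow_le_one₀ (norm_nonneg _) h1'
      have h6 := norm_add_le_of_support (Real.sqrt_nonneg (2 * k + 1)) h2 h2' h5' (by
        rw [Real.sq_sqrt (by positivity)]; linarith)
      rw [lt_div_iff₀ (by positivity)] at hr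
      have h7 : (m : ℝ) * (1 / 2) ^ r ≤ (1 / 2) ^ r * (m + 1) := by
        have : (0 : ℝ) ≤ (1 / 2) ^ r := by positivity
        nlinarith
      linarith
    · rw [add_apply, h2 i ((le_max_left _ _).trans hi), h3' i ((le_max_right _ _).trans hi),
        add_zero]
    · rw [map_add, map_add]
      push_cast
      linarith

end Shrinking

/-- The basis of unit vectors is shrinking. -/
theorem exists_norm_sub_comp_proj_le (g : StrongDual 𝕜 (BaernsteinSpace 𝕜)) {ε : ℝ} (hε : 0 < ε) :
    ∃ n, ∀ x, ‖g (x - proj 𝕜 n x)‖ ≤ ε * ‖x‖ := by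
  by_contra! hne
  have hg : ∀ n, ∃ x : BaernsteinSpace 𝕜, ‖x‖ ≤ 1 ∧ ε / 2 < ‖g (x - proj 𝕜 n x)‖ := fun n => by
    obtain ⟨x, hx⟩ := hne n
    have hx0 : 0 < ‖x‖ := by
      rw [norm_pos_iff]; rintro rfl; simp at hx
    refine ⟨((‖x‖⁻¹ : ℝ) : 𝕜) • x, ?_, ?_⟩
    · rw [norm_smul, RCLike.norm_ofReal, abs_of_pos (by positivity), inv_mul_cancel₀ hx0.ne']
    · rw [map_smul, ← smul_sub, map_smul, norm_smul, RCLike.norm_ofReal,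
        abs_of_pos (by positivity), inv_mul_eq_div, lt_div_iff₀ hx0]
      nlinarith
  -- A sum of `k` blocks has norm at most `√(2 * k)` but `g` is at least `k * ε / 2` on it, which
  -- forces `k * ε ^ 2 ≤ 8 * ‖g‖ ^ 2`.
  obtain ⟨k, hk⟩ := exists_nat_gt (8 * ‖g‖ ^ 2 / ε ^ 2)
  obtain ⟨w, m, h1, -, h3⟩ := exists_sum_blocks hg k
  have hk0 : (0 : ℝ) < k := lt_of_le_of_lt (by positivity) hk
  have h4 : k * (ε / 2) ≤ ‖g‖ * √(2 * k) :=
    (h3.trans (RCLike.re_le_norm _)).trans ((g.le_opNorm w).trans (by gcongr))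
  have h5 : (k * (ε / 2)) ^ 2 ≤ (‖g‖ * √(2 * k)) ^ 2 := by gcongr
  rw [mul_pow, mul_pow, Real.sq_sqrt (by positivity)] at h5
  rw [div_lt_iff₀ (by positivity)] at hk
  nlinarith

theorem apply_proj (g : StrongDual 𝕜 (BaernsteinSpace 𝕜)) (n : ℕ) (x : BaernsteinSpace 𝕜) :
    g (proj 𝕜 n x) = ∑ i ∈ Finset.range n, g (unit 𝕜 i) * x.1 i := by
  rw [proj_eq_sum, map_sum]
  exact Finset.sum_congr rfl fun i _ => by rw [map_smul, smul_eq_mul, mul_comm]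

theorem comp_proj_eq_sum (g : StrongDual 𝕜 (BaernsteinSpace 𝕜)) (n : ℕ) :
    g.comp (proj 𝕜 n) = ∑ i ∈ Finset.range n, g (unit 𝕜 i) • coord 𝕜 i := by
  ext x
  simp [apply_proj]

theorem norm_sub_comp_proj_le {g : StrongDual 𝕜 (BaernsteinSpace 𝕜)} {ε : ℝ} (hε : 0 ≤ ε) {n : ℕ}
    (h : ∀ x, ‖g (x - proj 𝕜 n x)‖ ≤ ε * ‖x‖) : ‖g - g.comp (proj 𝕜 n)‖ ≤ ε :=
  ContinuousLinearMap.opNorm_le_bound _ hε fun x => by simpa using h x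

theorem norm_unit_le (n : ℕ) : ‖unit 𝕜 n‖ ≤ 1 := by
  refine norm_le_of_gauge_le zero_le_one (iSup_le fun κ => ?_)
  rw [ENNReal.ofReal_one, tsum_eq_single n fun i hi => by
    rw [modulus, unit_apply, if_neg hi, enorm_zero, mul_zero]]
  rw [modulus, unit_apply, if_pos rfl]
  simpa using κ.2.le_one n

theorem weaklyNull_unit : WeaklyNull 𝕜 (unit 𝕜) := fun g => by
  refine Metric.tendsto_atTop.2 fun ε hε => ?_
  obtain ⟨n, hn⟩ := exists_norm_sub_comp_proj_le g (half_pos hε)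
  refine ⟨n, fun m hm => ?_⟩
  have h1 : proj 𝕜 n (unit 𝕜 m) = 0 := proj_eq_zero_of_support fun i hi => by
    rw [unit_apply, if_neg (by omega)]
  have h2 := hn (unit 𝕜 m)
  rw [h1, sub_zero] at h2
  rw [dist_zero_right]
  have := norm_unit_le (𝕜 := 𝕜) m
  nlinarith

/-- The basis is boundedly complete, since the gauge is determined by finite heads, so the
coordinates `F (coord i)` define a vector. The basis is shrinking, so `F` is determined by these
coordinates. -/
theorem isReflexive : IsReflexive 𝕜 (BaernsteinSpace 𝕜) := by
  intro F
  set b : ℕ → 𝕜 := fun i => F (coord 𝕜 i) with hb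
  set v : ℕ → BaernsteinSpace 𝕜 := fun n => ∑ i ∈ Finset.range n, b i • unit 𝕜 i with hv
  have hFv : ∀ (g : StrongDual 𝕜 (BaernsteinSpace 𝕜)) n, g (v n) = F (g.comp (proj 𝕜 n)) :=
    fun g n => by
      rw [comp_proj_eq_sum, hv, map_sum, map_sum]
      exact Finset.sum_congr rfl fun i _ => by
        rw [map_smul, map_smul, smul_eq_mul, smul_eq_mul, mul_comm]
  have hproj : ∀ (g : StrongDual 𝕜 (BaernsteinSpace 𝕜)) n, ‖g.comp (proj 𝕜 n)‖ ≤ ‖g‖ :=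
    fun g n => ContinuousLinearMap.opNorm_le_bound _ (norm_nonneg _) fun x =>
      (g.le_opNorm _).trans (by gcongr; exact norm_proj_le n x)
  have hvF : ∀ n, ‖v n‖ ≤ ‖F‖ := fun n =>
    NormedSpace.norm_le_dual_bound 𝕜 _ (norm_nonneg F) fun g => by
      rw [hFv]
      exact (F.le_opNorm _).trans (by gcongr; exact hproj g n)
  have hmem : baernsteinGauge (fun i => ‖b i‖ₑ) ≠ ⊤ := by
    refine ne_top_of_le_ne_top (ENNReal.ofReal_ne_top (r := ‖F‖))
      (baernsteinGauge_le_of_head fun n => ?_)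
    have h1 : head n (fun i => ‖b i‖ₑ) = (v n).modulus := by
      funext i
      rw [modulus, hv, sum_smul_unit_apply, head]
      split_ifs <;> simp
    rw [h1, ← ofReal_norm_eq]
    exact ENNReal.ofReal_le_ofReal (hvF n)
  let w : BaernsteinSpace 𝕜 := ⟨b, hmem⟩
  refine ⟨w, ?_⟩
  ext g
  rw [NormedSpace.dual_def]
  refine eq_of_sub_eq_zero (norm_le_zero_iff.1 (le_of_forall_pos_le_add fun ε hε => ?_))
  obtain ⟨n, hn⟩ := exists_norm_sub_comp_proj_le g
    (show 0 < ε / (‖w‖ + ‖F‖ + 1) by positivity)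
  have h1 : proj 𝕜 n w = v n := proj_eq_sum n w
  have h2 := hn w
  have h3 := (F.le_opNorm (g - g.comp (proj 𝕜 n))).trans
    (mul_le_mul_of_nonneg_left (norm_sub_comp_proj_le (by positivity) hn) (norm_nonneg F))
  have h4 : g w - F g = g (w - proj 𝕜 n w) - F (g - g.comp (proj 𝕜 n)) := by
    rw [map_sub, map_sub, h1, hFv]
    ring
  rw [h4, zero_add]
  refine (norm_sub_le _ _).trans ((add_le_add h2 h3).trans ?_)
  rw [mul_comm ‖F‖, ← mul_add, div_mul_eq_mul_div, div_le_iff₀ (by positivity)]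
  nlinarith

theorem separableSpace : TopologicalSpace.SeparableSpace (BaernsteinSpace 𝕜) := by
  have h := ((Set.countable_range (unit 𝕜)).isSeparable.span (R := 𝕜)).closure
  refine TopologicalSpace.isSeparable_univ_iff.1 (h.mono fun x _ => ?_)
  refine mem_closure_of_tendsto (tendsto_proj x) (Eventually.of_forall fun n => ?_)
  rw [proj_eq_sum]
  exact Submodule.sum_mem _ fun i _ => Submodule.smul_mem _ _ (Submodule.subset_span ⟨i, rfl⟩)

theorem separableSpace_dual :
    TopologicalSpace.SeparableSpace (StrongDual 𝕜 (BaernsteinSpace 𝕜)) := by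
  have h := ((Set.countable_range (coord 𝕜)).isSeparable.span (R := 𝕜)).closure
  refine TopologicalSpace.isSeparable_univ_iff.1 (h.mono fun g _ => ?_)
  refine Metric.mem_closure_iff.2 fun ε hε => ?_
  obtain ⟨n, hn⟩ := exists_norm_sub_comp_proj_le g (half_pos hε)
  refine ⟨g.comp (proj 𝕜 n), ?_, ?_⟩
  · rw [comp_proj_eq_sum]
    exact Submodule.sum_mem _ fun i _ => Submodule.smul_mem _ _ (Submodule.subset_span ⟨i, rfl⟩)
  · rw [dist_eq_norm]
    exact (norm_sub_comp_proj_le (half_pos hε).le hn).trans_lt (half_lt_self hε)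

end BaernsteinSpace

/-- The images of `n, …, 2 n - 1` under a strictly increasing map form a Schreier set. -/
theorem card_image_Ico_le {φ : ℕ → ℕ} (hφ : StrictMono φ) (n : ℕ) :
    ∀ i ∈ (Finset.Ico n (2 * n)).image φ, ((Finset.Ico n (2 * n)).image φ).card ≤ i + 1 := by
  intro i hi
  obtain ⟨j, hj, rfl⟩ := Finset.mem_image.1 hi
  rw [Finset.card_image_of_injective _ hφ.injective, Nat.card_Ico]
  have := hφ.le_apply (x := j)
  have := (Finset.mem_Ico.1 hj).1
  omega

/-- Means of every subsequence of `x` stay away from `0` as soon as sums over the second half of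
the first `2 n` terms have norm at least `n`. -/
theorem not_tendsto_cesaroMean_zero {𝕜 : Type*} [RCLike 𝕜] {X : Type*} [NormedAddCommGroup X]
    [NormedSpace 𝕜 X] {y : ℕ → X} (h : ∀ n : ℕ, (n : ℝ) ≤ ‖∑ i ∈ Finset.range (2 * n), y i‖) :
    ¬ Tendsto (cesaroMean 𝕜 y) atTop (𝓝 0) := by
  intro h0
  obtain ⟨N, hN⟩ := Metric.tendsto_atTop.1 h0 (1 / 2) (by norm_num)
  have h1 := hN (2 * (N + 1) - 1) (by omega)
  have h2 := h (N + 1)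
  rw [dist_zero_right, norm_cesaroMean, show 2 * (N + 1) - 1 + 1 = 2 * (N + 1) by omega,
    inv_mul_lt_iff₀ (by positivity)] at h1
  have h3 : ((2 * (N + 1) - 1 : ℕ) : ℝ) + 1 = 2 * (N + 1) := by
    have : 2 * (N + 1) - 1 + 1 = 2 * (N + 1) := by omega
    exact_mod_cast this
  rw [h3] at h1
  push_cast at h2
  linarith

/-! ### The unit vectors of Baernstein's space meet the criterion -/

namespace BaernsteinSpace

variable {𝕜 : Type*} [RCLike 𝕜]

/-- The indices of the second half of the sum form a Schreier set with `n` elements, on which the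
norm dominates the `ℓ¹`-norm. -/
theorem le_norm_sum_unit {φ : ℕ → ℕ} (hφ : StrictMono φ) (n : ℕ) :
    (n : ℝ) ≤ ‖∑ i ∈ Finset.range (2 * n), unit 𝕜 (φ i)‖ := by
  refine le_trans (le_of_eq ?_) (norm_sum_le (card_image_Ico_le hφ n) _)
  rw [Finset.sum_image hφ.injective.injOn]
  have : ∀ j ∈ Finset.Ico n (2 * n),
      ‖(∑ i ∈ Finset.range (2 * n), unit 𝕜 (φ i)).1 (φ j)‖ = 1 := fun j hj => by
    rw [sum_apply]
    simp only [unit_apply, hφ.injective.eq_iff]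
    rw [Finset.sum_ite_eq, if_pos (Finset.mem_range.2 (Finset.mem_Ico.1 hj).2), norm_one]
  rw [Finset.sum_congr rfl this, Finset.sum_const, Nat.card_Ico, nsmul_eq_mul, mul_one]
  congr 1
  omega

theorem wbs_eq_two : wbs 𝕜 (Metric.closedBall (0 : BaernsteinSpace 𝕜) 1) = 2 :=
  wbs_eq_two_of_weaklyNull norm_unit_le weaklyNull_unit fun _ hφ =>
    not_tendsto_cesaroMean_zero (le_norm_sum_unit hφ)

end BaernsteinSpace

/-! ### The space `c₀`: separable dual, not reflexive -/

section CZero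

open scoped ZeroAtInfty

variable {𝕜 : Type*} [RCLike 𝕜]

variable (𝕜) in
/-- The space `c₀`. -/
def CZero : Type _ := C₀(ℕ, 𝕜)

noncomputable instance : NormedAddCommGroup (CZero 𝕜) :=
  inferInstanceAs (NormedAddCommGroup C₀(ℕ, 𝕜))

noncomputable instance : NormedSpace 𝕜 (CZero 𝕜) :=
  inferInstanceAs (NormedSpace 𝕜 C₀(ℕ, 𝕜))

instance : CompleteSpace (CZero 𝕜) :=
  inferInstanceAs (CompleteSpace C₀(ℕ, 𝕜))

instance : FunLike (CZero 𝕜) ℕ 𝕜 :=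
  inferInstanceAs (FunLike C₀(ℕ, 𝕜) ℕ 𝕜)

theorem CZero.sub_apply (f g : CZero 𝕜) (i : ℕ) : (f - g) i = f i - g i := rfl

theorem CZero.tendsto_zero (f : CZero 𝕜) : Tendsto (fun i => f i) atTop (𝓝 0) := by
  have h : Tendsto (fun i => f i) (cocompact ℕ) (𝓝 0) :=
    ZeroAtInftyContinuousMap.zero_at_infty' (α := ℕ) (β := 𝕜) f
  rwa [cocompact_eq_cofinite, Nat.cofinite_eq_atTop] at h

theorem CZero.norm_apply_le (f : CZero 𝕜) (i : ℕ) : ‖f i‖ ≤ ‖f‖ :=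
  (ZeroAtInftyContinuousMap.toBCF (α := ℕ) (β := 𝕜) f).norm_coe_le_norm i

theorem CZero.norm_le {f : CZero 𝕜} {C : ℝ} (hC : 0 ≤ C) (h : ∀ i, ‖f i‖ ≤ C) : ‖f‖ ≤ C :=
  (BoundedContinuousFunction.norm_le hC
    (f := ZeroAtInftyContinuousMap.toBCF (α := ℕ) (β := 𝕜) f)).2 h

variable (𝕜) in
/-- The unit vectors of `c₀`. -/
noncomputable def czUnit (n : ℕ) : CZero 𝕜 :=
  (⟨⟨Pi.single n 1, continuous_of_discreteTopology⟩, by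
    rw [cocompact_eq_cofinite]
    refine tendsto_const_nhds.congr' ?_
    filter_upwards [(Set.finite_singleton n).compl_mem_cofinite] with i hi
    rw [Pi.single_eq_of_ne (by simpa using hi)]⟩ : C₀(ℕ, 𝕜))

theorem czUnit_apply (n i : ℕ) : czUnit 𝕜 n i = if i = n then 1 else 0 :=
  Pi.single_apply n 1 i

variable (𝕜) in
/-- The coordinate functionals of `c₀`. -/
noncomputable def czCoord (i : ℕ) : StrongDual 𝕜 (CZero 𝕜) :=
  LinearMap.mkContinuous
    { toFun := fun f => f i
      map_add' := fun _ _ => rfl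
      map_smul' := fun _ _ => rfl } 1 fun f => by
    rw [one_mul]
    exact f.norm_apply_le i

@[simp] theorem czCoord_apply (i : ℕ) (f : CZero 𝕜) : czCoord 𝕜 i f = f i := rfl

theorem norm_czCoord_le (i : ℕ) : ‖czCoord 𝕜 i‖ ≤ 1 :=
  LinearMap.mkContinuous_norm_le _ zero_le_one _

theorem sum_smul_czUnit_apply (s : Finset ℕ) (b : ℕ → 𝕜) (i : ℕ) :
    (∑ j ∈ s, b j • czUnit 𝕜 j) i = if i ∈ s then b i else 0 := by
  rw [← czCoord_apply, map_sum]
  simp [czUnit_apply]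

theorem sum_norm_apply_czUnit_le (g : StrongDual 𝕜 (CZero 𝕜)) (s : Finset ℕ) :
    ∑ i ∈ s, ‖g (czUnit 𝕜 i)‖ ≤ ‖g‖ := by
  choose c hc hcg using fun i => RCLike.exists_norm_eq_mul_self (g (czUnit 𝕜 i))
  have h1 : ‖∑ i ∈ s, c i • czUnit 𝕜 i‖ ≤ 1 := CZero.norm_le zero_le_one fun i => by
    rw [sum_smul_czUnit_apply]
    split_ifs
    · exact (hc i).le
    · simp
  have h2 : g (∑ i ∈ s, c i • czUnit 𝕜 i) = ((∑ i ∈ s, ‖g (czUnit 𝕜 i)‖ : ℝ) : 𝕜) := by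
    rw [map_sum, RCLike.ofReal_sum]
    exact Finset.sum_congr rfl fun i _ => by rw [map_smul, smul_eq_mul, hcg]
  have h3 := g.le_opNorm (∑ i ∈ s, c i • czUnit 𝕜 i)
  rw [h2, RCLike.norm_ofReal, abs_of_nonneg (Finset.sum_nonneg fun _ _ => norm_nonneg _)] at h3
  exact h3.trans (mul_le_of_le_one_right (norm_nonneg _) h1)

theorem summable_norm_apply_czUnit (g : StrongDual 𝕜 (CZero 𝕜)) :
    Summable fun i => ‖g (czUnit 𝕜 i)‖ :=
  summable_of_sum_le (fun _ => norm_nonneg _) (sum_norm_apply_czUnit_le g)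

theorem tendsto_sum_smul_czUnit (f : CZero 𝕜) :
    Tendsto (fun n => ∑ i ∈ Finset.range n, f i • czUnit 𝕜 i) atTop (𝓝 f) := by
  have hf := f.tendsto_zero
  rw [tendsto_iff_norm_sub_tendsto_zero, Metric.tendsto_atTop]
  intro ε hε
  obtain ⟨N, hN⟩ := Metric.tendsto_atTop.1 hf (ε / 2) (half_pos hε)
  refine ⟨N, fun n hn => ?_⟩
  rw [dist_zero_right, norm_norm]
  refine lt_of_le_of_lt (CZero.norm_le (half_pos hε).le fun i => ?_) (half_lt_self hε)
  rw [CZero.sub_apply, sum_smul_czUnit_apply]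
  split_ifs with hi
  · simpa using (half_pos hε).le
  · have := hN i (hn.trans (by simpa using hi))
    rw [dist_zero_right] at this
    rw [zero_sub, norm_neg]
    exact this.le

theorem hasSum_dual_cz (g : StrongDual 𝕜 (CZero 𝕜)) :
    HasSum (fun i => g (czUnit 𝕜 i) • czCoord 𝕜 i) g := by
  have hsum : Summable fun i => g (czUnit 𝕜 i) • czCoord 𝕜 i :=
    Summable.of_norm_bounded (summable_norm_apply_czUnit g) fun i => by
      rw [norm_smul]
      exact mul_le_of_le_one_right (norm_nonneg _) (norm_czCoord_le i)
  convert hsum.hasSum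
  ext f
  have h1 := (hsum.hasSum.mapL (ContinuousLinearMap.apply 𝕜 𝕜 f)).tendsto_sum_nat
  refine tendsto_nhds_unique ((g.continuous.tendsto f).comp (tendsto_sum_smul_czUnit f))
    (h1.congr fun n => ?_)
  simp only [Function.comp_apply, map_sum, map_smul]
  exact Finset.sum_congr rfl fun i _ => by simp [mul_comm]

theorem separableSpace_dual_cz : TopologicalSpace.SeparableSpace (StrongDual 𝕜 (CZero 𝕜)) := by
  have h := ((Set.countable_range (czCoord 𝕜)).isSeparable.span (R := 𝕜)).closure
  refine TopologicalSpace.isSeparable_univ_iff.1 (h.mono fun g _ => ?_)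
  refine mem_closure_of_tendsto (hasSum_dual_cz g) (Eventually.of_forall fun s => ?_)
  exact Submodule.sum_mem _ fun i _ => Submodule.smul_mem _ _ (Submodule.subset_span ⟨i, rfl⟩)

/-- The functional `g ↦ ∑ g (e_i)` on the dual could only come from the constant sequence 1, which
does not tend to 0. -/
theorem not_isReflexive_cz : ¬ IsReflexive 𝕜 (CZero 𝕜) := by
  intro h
  have hsum : ∀ g : StrongDual 𝕜 (CZero 𝕜), Summable fun i => g (czUnit 𝕜 i) :=
    fun g => (summable_norm_apply_czUnit g).of_norm
  let F : StrongDual 𝕜 (StrongDual 𝕜 (CZero 𝕜)) := LinearMap.mkContinuous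
    { toFun := fun g => ∑' i, g (czUnit 𝕜 i)
      map_add' := fun g g' => (hsum g).tsum_add (hsum g')
      map_smul' := fun c g => (hsum g).tsum_const_smul c } 1 fun g => by
    rw [one_mul]
    exact (norm_tsum_le_tsum_norm (summable_norm_apply_czUnit g)).trans
      (Real.tsum_le_of_sum_le (fun _ => norm_nonneg _) (sum_norm_apply_czUnit_le g))
  obtain ⟨f, hf⟩ := h F
  have h1 : ∀ i, f i = 1 := fun i => by
    have h2 := DFunLike.congr_fun hf (czCoord 𝕜 i)
    rw [NormedSpace.dual_def, czCoord_apply] at h2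
    have h3 : F (czCoord 𝕜 i) = ∑' j, czCoord 𝕜 i (czUnit 𝕜 j) := rfl
    rw [h2, h3, tsum_eq_single i fun j hj => by simp [czUnit_apply, hj.symm]]
    simp [czUnit_apply]
  have hf0 := f.tendsto_zero
  simp only [h1] at hf0
  exact one_ne_zero (tendsto_nhds_unique tendsto_const_nhds hf0)

end CZero

/-! ### Products with Baernstein's space -/

section Prod

variable {𝕜 : Type*} [RCLike 𝕜] {X Y : Type*} [NormedAddCommGroup X] [NormedSpace 𝕜 X]
  [NormedAddCommGroup Y] [NormedSpace 𝕜 Y]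

theorem IsReflexive.of_prod_right (h : IsReflexive 𝕜 (X × Y)) : IsReflexive 𝕜 Y := by
  intro F
  obtain ⟨⟨x, y⟩, hxy⟩ := h (F.comp (ContinuousLinearMap.precomp 𝕜
    (ContinuousLinearMap.inr 𝕜 X Y)))
  refine ⟨y, ?_⟩
  ext g
  have h1 := DFunLike.congr_fun hxy (g.comp (ContinuousLinearMap.snd 𝕜 X Y))
  rw [NormedSpace.dual_def] at h1 ⊢
  have h2 : ContinuousLinearMap.precomp 𝕜 (ContinuousLinearMap.inr 𝕜 X Y)
      (g.comp (ContinuousLinearMap.snd 𝕜 X Y)) = g := by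
    ext z
    rfl
  exact h1.trans (congrArg F h2)

theorem separableSpace_dual_prod [TopologicalSpace.SeparableSpace (StrongDual 𝕜 X)]
    [TopologicalSpace.SeparableSpace (StrongDual 𝕜 Y)] :
    TopologicalSpace.SeparableSpace (StrongDual 𝕜 (X × Y)) := by
  let T : StrongDual 𝕜 X × StrongDual 𝕜 Y → StrongDual 𝕜 (X × Y) := fun p =>
    p.1.comp (ContinuousLinearMap.fst 𝕜 X Y) + p.2.comp (ContinuousLinearMap.snd 𝕜 X Y)
  have hT : Continuous T := by fun_prop
  have hsurj : Function.Surjective T := fun g =>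
    ⟨(g.comp (ContinuousLinearMap.inl 𝕜 X Y), g.comp (ContinuousLinearMap.inr 𝕜 X Y)), by
      refine ContinuousLinearMap.ext fun p => ?_
      simp only [T, add_apply, ContinuousLinearMap.comp_apply]
      rw [← map_add]
      simp⟩
  exact hsurj.denseRange.separableSpace hT

theorem wbs_prod_baernstein :
    wbs 𝕜 (Metric.closedBall (0 : BaernsteinSpace 𝕜 × Y) 1) = 2 := by
  refine wbs_eq_two_of_weaklyNull (𝕜 := 𝕜)
    (x := fun n => ContinuousLinearMap.inl 𝕜 (BaernsteinSpace 𝕜) Y (BaernsteinSpace.unit 𝕜 n))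
    (C := 1) (fun n => ?_)
    (fun g => BaernsteinSpace.weaklyNull_unit (g.comp (ContinuousLinearMap.inl 𝕜 _ Y)))
    fun φ hφ => not_tendsto_cesaroMean_zero fun n => ?_
  · simpa [Prod.norm_def] using BaernsteinSpace.norm_unit_le n
  · simp only [Function.comp_apply]
    rw [← map_sum]
    refine (BaernsteinSpace.le_norm_sum_unit (𝕜 := 𝕜) hφ n).trans ?_
    rw [ContinuousLinearMap.inl_apply, Prod.norm_def]
    exact le_max_left _ _

end Prod

/-! ### Weak nullity by domination -/

section Domination

variable {𝕜 : Type*} [RCLike 𝕜] {Z : Type*} [NormedAddCommGroup Z] [NormedSpace 𝕜 Z]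

/-- A sequence dominated by the unit vector basis of Baernstein's space is weakly null. -/
theorem weaklyNull_of_dominated {f : ℕ → Z}
    (hf : ∀ (x : BaernsteinSpace 𝕜) n, ‖∑ i ∈ Finset.range n, x.1 i • f i‖ ≤ ‖x‖) :
    WeaklyNull 𝕜 f := by
  intro g
  let T : ℕ → BaernsteinSpace 𝕜 →L[𝕜] Z := fun n =>
    ∑ i ∈ Finset.range n, (BaernsteinSpace.coord 𝕜 i).smulRight (f i)
  have hT : ∀ n x, T n x = ∑ i ∈ Finset.range n, x.1 i • f i := fun n x => by
    simp [T]
  have hTnorm : ∀ n x, ‖T n x‖ ≤ ‖x‖ := fun n x => by rw [hT]; exact hf x n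
  have hTproj : ∀ N n, N ≤ n → ∀ x, T n (BaernsteinSpace.proj 𝕜 N x) = T N x := by
    intro N n h x
    rw [hT, hT, sum_range_eq_add_sum_range h]
    have h1 : ∑ i ∈ Finset.range (n - N), (BaernsteinSpace.proj 𝕜 N x).1 (N + i) • f (N + i) = 0 :=
      Finset.sum_eq_zero fun i _ => by
        rw [BaernsteinSpace.proj_apply, if_neg (by omega), zero_smul]
    rw [h1, add_zero]
    refine Finset.sum_congr rfl fun i hi => ?_
    rw [BaernsteinSpace.proj_apply, if_pos (Finset.mem_range.1 hi)]
  have hlim : ∀ x, ∃ l, Tendsto (fun n => (g.comp (T n)) x) atTop (𝓝 l) := by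
    intro x
    refine cauchySeq_tendsto_of_complete (cauchySeq_of_le_tendsto_0
      (fun N => 2 * (‖g‖ * ‖x - BaernsteinSpace.proj 𝕜 N x‖)) (fun n m N hn hm => ?_) ?_)
    · set y := x - BaernsteinSpace.proj 𝕜 N x with hy
      have h1 : (g.comp (T n)) x - (g.comp (T m)) x = g (T n y) - g (T m y) := by
        rw [hy, map_sub (T n), map_sub (T m), hTproj N n hn, hTproj N m hm, map_sub, map_sub]
        simp
      rw [dist_eq_norm, h1]
      have h2 : ∀ k, ‖g (T k y)‖ ≤ ‖g‖ * ‖y‖ := fun k =>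
        (g.le_opNorm _).trans (by gcongr; exact hTnorm k y)
      linarith [norm_sub_le (g (T n y)) (g (T m y)), h2 n, h2 m]
    · have h1 := (tendsto_iff_norm_sub_tendsto_zero.1 (BaernsteinSpace.tendsto_proj x))
      have h2 := (h1.const_mul ‖g‖).const_mul 2
      simp only [mul_zero] at h2
      exact h2.congr fun N => by rw [norm_sub_rev]
  choose L hL using hlim
  -- `G` pulls `g` back along the formal map sending `e_i` to `f i`. Taking the limit after applying
  -- `g` makes completeness of `Z` unnecessary.
  let G : StrongDual 𝕜 (BaernsteinSpace 𝕜) :=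
    continuousLinearMapOfTendsto (fun n => g.comp (T n)) (tendsto_pi_nhds.2 hL)
  have hG : ∀ m, G (BaernsteinSpace.unit 𝕜 m) = g (f m) := fun m => by
    refine tendsto_nhds_unique (hL (BaernsteinSpace.unit 𝕜 m)) (tendsto_const_nhds.congr' ?_)
    filter_upwards [eventually_gt_atTop m] with n hn
    rw [ContinuousLinearMap.comp_apply, hT]
    simp only [BaernsteinSpace.unit_apply, ite_smul, one_smul, zero_smul]
    rw [Finset.sum_ite_eq', if_pos (Finset.mem_range.2 hn)]
  exact (BaernsteinSpace.weaklyNull_unit G).congr hG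

end Domination

/-! ### Schreier functions on the unit interval -/

section UnitInterval

/-- Independent continuous functions: every pattern of zeros and ones is attained. -/
theorem exists_independent_functions :
    ∃ g : ℕ → C(Set.Icc (0 : ℝ) 1, ℝ), ∀ S : Set ℕ, ∃ t, ∀ n,
      (n ∈ S → g n t = 1) ∧ (n ∉ S → g n t = 0) := by
  classical
  -- The Cantor set is a closed copy of `{0,1}^ℕ` in the interval; Tietze's theorem extends its
  -- coordinate functions.
  let e : (ℕ → Bool) → Set.Icc (0 : ℝ) 1 := fun b =>
    ⟨cantorSetHomeomorphNatToBool.symm b,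
      cantorSet_subset_unitInterval (cantorSetHomeomorphNatToBool.symm b).2⟩
  have he : Continuous e := Continuous.subtype_mk
    (continuous_subtype_val.comp cantorSetHomeomorphNatToBool.symm.continuous) _
  have hinj : Function.Injective e := fun b b' h =>
    cantorSetHomeomorphNatToBool.symm.injective 
      (Subtype.ext (congrArg (fun z : Set.Icc (0 : ℝ) 1 => (z : ℝ)) h))
  have hemb : IsClosedEmbedding e := he.isClosedEmbedding hinj
  have hext : ∀ n, ∃ g : C(Set.Icc (0 : ℝ) 1, ℝ), ∀ b, g (e b) = if b n then 1 else 0 := fun n => by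
    obtain ⟨g, hg⟩ := ContinuousMap.exists_extension' hemb
      (⟨fun b : ℕ → Bool => if b n then (1 : ℝ) else 0,
        (continuous_of_discreteTopology (f := fun c : Bool => if c then (1 : ℝ) else 0)).comp
          (continuous_apply n)⟩ : C(ℕ → Bool, ℝ))
    exact ⟨g, fun b => congrFun hg b⟩
  choose g hg using hext
  refine ⟨g, fun S => ⟨e fun n => decide (n ∈ S), fun n => ⟨fun h => ?_, fun h => ?_⟩⟩⟩ <;>
    simp [hg, h]

/-- The Schreier property of a finite set. -/
def IsSchreier (F : Finset ℕ) : Prop := ∀ i ∈ F, F.card ≤ i + 1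

theorem IsSchreier.mono {F G : Finset ℕ} (hG : IsSchreier G) (h : F ⊆ G) : IsSchreier F :=
  fun i hi => (Finset.card_le_card h).trans (hG i (h hi))

/-- Functions on `[0, 1]` whose finite sets of simultaneous nonvanishing are exactly controlled by
the Schreier family. -/
theorem exists_schreier_functions :
    ∃ f : ℕ → C(Set.Icc (0 : ℝ) 1, ℝ), (∀ n t, 0 ≤ f n t) ∧ (∀ n t, f n t ≤ 1) ∧
      (∀ (F : Finset ℕ) t, (∀ i ∈ F, f i t ≠ 0) → IsSchreier F) ∧
      ∀ F : Finset ℕ, IsSchreier F → ∃ t, ∀ i ∈ F, f i t = 1 := by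
  classical
  obtain ⟨g, hg⟩ := exists_independent_functions
  let c : ℝ → ℝ := fun s => max 0 (min 1 s)
  have hc : Continuous c := by fun_prop
  have hc0 : ∀ s, 0 ≤ c s := fun s => le_max_left _ _
  have hc1 : ∀ s, c s ≤ 1 := fun s => max_le zero_le_one (min_le_left _ _)
  -- Two thresholds: wherever the leading factor `c (2 * s - 1)` is nonzero, the cutoff `c (2 * s)`
  -- used in the products has already reached 1.
  have hcpos : ∀ s, c (2 * s - 1) ≠ 0 → c (2 * s) = 1 := fun s h => by
    have h1 : 0 < 2 * s - 1 := by
      by_contra! hle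
      exact h (max_eq_left ((min_le_right _ _).trans hle))
    simp only [c]
    rw [min_eq_left (by linarith), max_eq_right zero_le_one]
  -- Non-Schreier sets with maximum `n`. The factor `1 - P F` in `Q n` makes the function of index
  -- `n = max F` vanish wherever the leading factors of all members of `F` are nonzero.
  let bad : ℕ → Finset (Finset ℕ) := fun n =>
    (Finset.range (n + 1)).powerset.filter fun F => n ∈ F ∧ ¬ IsSchreier F
  let P : Finset ℕ → Set.Icc (0 : ℝ) 1 → ℝ := fun F t => ∏ i ∈ F, c (2 * g i t)
  have hP0 : ∀ F t, 0 ≤ P F t := fun F t => Finset.prod_nonneg fun i _ => hc0 _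
  have hP1 : ∀ F t, P F t ≤ 1 := fun F t => Finset.prod_le_one (fun i _ => hc0 _) fun i _ => hc1 _
  let Q : ℕ → Set.Icc (0 : ℝ) 1 → ℝ := fun n t => ∏ F ∈ bad n, (1 - P F t)
  have hQ0 : ∀ n t, 0 ≤ Q n t := fun n t =>
    Finset.prod_nonneg fun F _ => sub_nonneg.2 (hP1 F t)
  have hQ1 : ∀ n t, Q n t ≤ 1 := fun n t =>
    Finset.prod_le_one (fun F _ => sub_nonneg.2 (hP1 F t)) fun F _ => by
      linarith [hP0 F t]
  have hcont : ∀ n, Continuous fun t => c (2 * g n t - 1) * Q n t := fun n => by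
    refine (hc.comp (by fun_prop)).mul (continuous_finsetProd _ fun F _ => ?_)
    exact continuous_const.sub (continuous_finsetProd _ fun i _ => hc.comp (by fun_prop))
  refine ⟨fun n => ⟨_, hcont n⟩, fun n t => mul_nonneg (hc0 _) (hQ0 n t),
    fun n t => mul_le_one₀ (hc1 _) (hQ0 n t) (hQ1 n t), fun F t hF => ?_, fun F hF => ?_⟩
  · by_contra hS
    have hne : F.Nonempty := by
      rw [Finset.nonempty_iff_ne_empty]
      rintro rfl
      exact hS fun i hi => by simp at hi
    set n := F.max' hne with hn
    have hnF : n ∈ F := F.max'_mem hne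
    have hbad : F ∈ bad n := by
      rw [Finset.mem_filter, Finset.mem_powerset]
      exact ⟨fun i hi => Finset.mem_range.2 (Nat.lt_succ_of_le (F.le_max' i hi)), hnF, hS⟩
    have hP : P F t = 1 := Finset.prod_eq_one fun i hi => hcpos _ (left_ne_zero_of_mul (hF i hi))
    have hQ : Q n t = 0 := Finset.prod_eq_zero hbad (by rw [hP, sub_self])
    exact hF n hnF (mul_eq_zero_of_right _ hQ)
  · obtain ⟨t, ht⟩ := hg (F : Set ℕ)
    refine ⟨t, fun i hi => ?_⟩
    have hgi : g i t = 1 := (ht i).1 hi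
    have hci : c (2 * g i t - 1) = 1 := by
      simp only [c, hgi]; norm_num
    -- The Schreier family is hereditary, so a bad `G` is not contained in `F` and some `j ∈ G` has
    -- `g j t = 0`.
    have hQ : Q i t = 1 := Finset.prod_eq_one fun G hG => by
      have hGS := (Finset.mem_filter.1 hG).2.2
      obtain ⟨j, hjG, hjF⟩ : ∃ j ∈ G, j ∉ F := by
        by_contra! hsub
        exact hGS (hF.mono hsub)
      have hgj : g j t = 0 := (ht j).2 hjF
      have : P G t = 0 := Finset.prod_eq_zero hjG (by simp [c, hgj])
      rw [this, sub_zero]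
    change c (2 * g i t - 1) * Q i t = 1
    rw [hci, hQ, mul_one]

variable {𝕜 : Type*} [RCLike 𝕜]

theorem wbs_continuousMap_eq_two :
    wbs 𝕜 (Metric.closedBall (0 : C(Set.Icc (0 : ℝ) 1, 𝕜)) 1) = 2 := by
  classical
  obtain ⟨f, hf0, hf1, hfS, hfF⟩ := exists_schreier_functions
  let F : ℕ → C(Set.Icc (0 : ℝ) 1, 𝕜) := fun n =>
    ⟨fun t => ((f n t : ℝ) : 𝕜), RCLike.continuous_ofReal.comp (f n).continuous⟩
  have hF : ∀ n t, F n t = ((f n t : ℝ) : 𝕜) := fun _ _ => rfl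
  have hFnorm : ∀ n t, ‖F n t‖ = f n t := fun n t => by
    rw [hF, RCLike.norm_ofReal, abs_of_nonneg (hf0 n t)]
  have hsum : ∀ (s : Finset ℕ) (h : ℕ → C(Set.Icc (0 : ℝ) 1, 𝕜)) t,
      (∑ i ∈ s, h i) t = ∑ i ∈ s, h i t := fun s h t => by
    rw [ContinuousMap.sum_apply]
  refine wbs_eq_two_of_weaklyNull (𝕜 := 𝕜) (x := F) (C := 1) (fun n => ?_) ?_
    fun φ hφ => not_tendsto_cesaroMean_zero fun n => ?_
  · refine (ContinuousMap.norm_le _ zero_le_one).2 fun t => ?_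
    rw [hFnorm]
    exact hf1 n t
  · refine weaklyNull_of_dominated fun x n => ?_
    refine (ContinuousMap.norm_le _ (norm_nonneg _)).2 fun t => ?_
    -- At each point only a Schreier set of the functions is active, and on it Baernstein's norm
    -- dominates the `ℓ¹`-norm.
    set S := (Finset.range n).filter fun i => f i t ≠ 0 with hS
    have hSS : IsSchreier S := hfS S t fun i hi => (Finset.mem_filter.1 hi).2
    refine le_trans ?_ (BaernsteinSpace.norm_sum_le hSS x)
    rw [hsum]
    have h1 : ∑ i ∈ Finset.range n, (x.1 i • F i) t = ∑ i ∈ S, (x.1 i • F i) t := by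
      refine (Finset.sum_filter_of_ne fun i _ hi => ?_).symm
      intro h0
      refine hi ?_
      rw [ContinuousMap.smul_apply, hF, h0, RCLike.ofReal_zero, smul_zero]
    rw [h1]
    refine norm_sum_le_of_le _ fun i _ => ?_
    rw [ContinuousMap.smul_apply, norm_smul, hFnorm]
    exact mul_le_of_le_one_right (norm_nonneg _) (hf1 i t)
  · obtain ⟨t, ht⟩ := hfF _ (card_image_Ico_le hφ n)
    refine le_trans ?_ (ContinuousMap.norm_coe_le_norm _ t)
    have h1 : (∑ i ∈ Finset.range (2 * n), (F ∘ φ) i) t =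
        ((∑ i ∈ Finset.range (2 * n), f (φ i) t : ℝ) : 𝕜) := by
      rw [hsum, RCLike.ofReal_sum]
      rfl
    rw [h1, RCLike.norm_ofReal, abs_of_nonneg (Finset.sum_nonneg fun i _ => hf0 _ _)]
    have h2 : ∑ i ∈ Finset.Ico n (2 * n), f (φ i) t = n := by
      have : ∀ i ∈ Finset.Ico n (2 * n), f (φ i) t = 1 := fun i hi =>
        ht _ (Finset.mem_image_of_mem φ hi)
      rw [Finset.sum_congr rfl this, Finset.sum_const, Nat.card_Ico, nsmul_eq_mul, mul_one]
      congr 1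
      omega
    rw [← h2]
    refine Finset.sum_le_sum_of_subset_of_nonneg (fun i hi => ?_) fun i _ _ => hf0 _ _
    exact Finset.mem_range.2 (Finset.mem_Ico.1 hi).2

end UnitInterval

end BanachSaks

theorem theorem5p1 (𝕜 : Type u) [RCLike 𝕜] :
    (∀ (X : Type v) [NormedAddCommGroup X] [NormedSpace 𝕜 X] [CompleteSpace X],
      (BanachSaks.HasWeakBanachSaks 𝕜 X →
        BanachSaks.wbs 𝕜 (Metric.closedBall (0 : X) 1) = 0) ∧
      (¬ BanachSaks.HasWeakBanachSaks 𝕜 X →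
        BanachSaks.wbs 𝕜 (Metric.closedBall (0 : X) 1) = 2)) ∧
    (∃ (X : Type u) (_ : NormedAddCommGroup X) (_ : NormedSpace 𝕜 X),
      CompleteSpace X ∧ TopologicalSpace.SeparableSpace X ∧
      BanachSaks.IsReflexive 𝕜 X ∧
      BanachSaks.bs 𝕜 (Metric.closedBall (0 : X) 1) = 2 ∧
      BanachSaks.wbs 𝕜 (Metric.closedBall (0 : X) 1) = 2) ∧
    (∃ (X : Type u) (_ : NormedAddCommGroup X) (_ : NormedSpace 𝕜 X),
      CompleteSpace X ∧ ¬ BanachSaks.IsReflexive 𝕜 X ∧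
      TopologicalSpace.SeparableSpace (StrongDual 𝕜 X) ∧
      BanachSaks.bs 𝕜 (Metric.closedBall (0 : X) 1) = 2 ∧
      BanachSaks.wbs 𝕜 (Metric.closedBall (0 : X) 1) = 2) ∧
    (BanachSaks.bs 𝕜 (Metric.closedBall (0 : C(Set.Icc (0 : ℝ) 1, 𝕜)) 1) = 2 ∧
      BanachSaks.wbs 𝕜 (Metric.closedBall (0 : C(Set.Icc (0 : ℝ) 1, 𝕜)) 1) = 2) := by
  refine ⟨fun X _ _ _ => ⟨fun h => BanachSaks.wbs_eq_zero_of_hasWeakBanachSaks h _,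
    BanachSaks.wbs_eq_two_of_not_hasWeakBanachSaks⟩, ?_, ?_, ?_⟩
  · exact ⟨BanachSaks.BaernsteinSpace 𝕜, inferInstance, inferInstance, inferInstance,
      BanachSaks.BaernsteinSpace.separableSpace, BanachSaks.BaernsteinSpace.isReflexive,
      BanachSaks.bs_eq_two_of_wbs_eq_two BanachSaks.BaernsteinSpace.wbs_eq_two,
      BanachSaks.BaernsteinSpace.wbs_eq_two⟩
  · have := BanachSaks.BaernsteinSpace.separableSpace_dual (𝕜 := 𝕜)
    have := BanachSaks.separableSpace_dual_cz (𝕜 := 𝕜)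
    exact ⟨BanachSaks.BaernsteinSpace 𝕜 × BanachSaks.CZero 𝕜, inferInstance, inferInstance,
      inferInstance, fun h => BanachSaks.not_isReflexive_cz h.of_prod_right,
      BanachSaks.separableSpace_dual_prod,
      BanachSaks.bs_eq_two_of_wbs_eq_two BanachSaks.wbs_prod_baernstein,
      BanachSaks.wbs_prod_baernstein⟩
  · exact ⟨BanachSaks.bs_eq_two_of_wbs_eq_two BanachSaks.wbs_continuousMap_eq_two,
      BanachSaks.wbs_continuousMap_eq_two⟩
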